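/- Conventions. A CAT(0) space is a complete geodesic metric space whose geodesic triangles are at least as thin as their Euclidean comparison triangles. A bounded sequence $(x_n)$ in a CAT(0) space $X$ converges weakly to $x\in X$ if for every compact geodesic $c$ starting at $x$ the closest-point projections of $x_n$ to $c$ converge to $x$. The weak topology $\mathcal T_\Delta$ on $X$ is the topology whose closed sets are the sets that contain every weak limit of every bounded sequence of their elements. The coconvex topology $\mathcal T_{co}$ is the coarsest topology on $X$ for which all metrically closed, convex subsets are closed. Construction. Let $Y_1$ be the metric tree obtained from countably infinitely many intervals $[0,\frac{\pi}{4}]$ by gluing them together at $0$. Fix one endpoint of $Y_1$, and let $Y$ be the metric tree obtained from countably infinitely many copies of $Y_1$ by gluing them together at this endpoint. Let $p\in Y$ be the gluing point, let $B\subset Y$ be the set of branching points different from $p$ (the centres of the copies of $Y_1$, at distance $\frac{\pi}{4}$ from $p$), and let $E\subset Y$ be the set of endpoints of $Y$. Let $\hat X$ be the Euclidean cone over $Y$ with tip $o$, that is, the set of points $s\cdot y$ with $s\ge 0$, $y\in Y$ and $0\cdot y=o$ for all $y$, with the metric $$d(s\cdot y,t\cdot y')^2=s^2+t^2-2st\cos\bigl(\min\{d_Y(y,y'),\pi\}\bigr).$$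 Identify $y\in Y$ with $1\cdot y\in\hat X$. Every edge of $Y$ has length $\frac{\pi}{4}$; for an edge with endpoints $y,y'$ let $S_{y,y'}\subset\hat X$ be the solid triangle with vertices $o,\,2\cdot y,\,2\cdot y'$, and let $X\subset\hat X$ be the union of the triangles $S_{y,y'}$ over all edges of $Y$, with the metric induced from $\hat X$. Put $$A = E\cup \tfrac{1}{\sqrt 2}\cdot B\cup\{\tfrac12\cdot p\}\cup\{o\}.$$ Statement. $X$ is a bounded CAT(0) space and $A\subset X$. The set $A$ is $\mathcal T_\Delta$-closed, whereas the point $\tfrac14\cdot p\in X\setminus A$ lies in the $\mathcal T_{co}$-closure of $A$. In particular, the topologies $\mathcal T_\Delta$ and $\mathcal T_{co}$ on $X$ do not coincide. -/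

import Mathlib

open scoped NNReal Topology

/-! ### CAT(0) spaces, weak convergence, and the two topologies -/

/-- `γ`, restricted to `[0, L]`, is a geodesic parametrized by arc length. -/
def IsGeodesic {X : Type} [MetricSpace X] (γ : ℝ → X) (L : ℝ) : Prop :=
  0 ≤ L ∧ ∀ s ∈ Set.Icc 0 L, ∀ t ∈ Set.Icc 0 L, dist (γ s) (γ t) = |s - t|

/-- `z` satisfies `d(x,z) + d(z,y) = d(x,y)`. In a geodesic space this says that `z` lies on
some geodesic from `x` to `y`. -/
def MetricBetween {X : Type} [MetricSpace X] (x z y : X) : Prop :=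
  dist x z + dist z y = dist x y

/-- A complete geodesic metric space in which every geodesic triangle is at least as thin as
its comparison triangle in the Euclidean plane: if `x` lies on a side `[p,q]`, `y` on a side
`[p,r]`, and `x'`, `y'` are the comparison points in a comparison triangle `p' q' r'`, then
`d(x,y) ≤ |x' - y'|`. -/
structure IsCAT0 (X : Type) [MetricSpace X] : Prop where
  complete : CompleteSpace X
  geodesic : ∀ x y : X, ∃ γ : ℝ → X,
    IsGeodesic γ (dist x y) ∧ γ 0 = x ∧ γ (dist x y) = y
  thin : ∀ (p q r x y : X) (p' q' r' x' y' : EuclideanSpace ℝ (Fin 2)),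
    dist p' q' = dist p q → dist q' r' = dist q r → dist p' r' = dist p r →
    MetricBetween p x q → dist p' x' = dist p x → dist x' q' = dist x q →
    MetricBetween p y r → dist p' y' = dist p y → dist y' r' = dist y r →
    dist x y ≤ dist x' y'

/-- `q` is a closest point of `S` to `x`. -/
def IsClosestPoint {X : Type} [MetricSpace X] (S : Set X) (x q : X) : Prop :=
  q ∈ S ∧ ∀ w ∈ S, dist x q ≤ dist x w

/-- For every compact geodesic `c` starting at `x`, the closest-point projections of `u n` to
`c` converge to `x`. -/
def WeaklyConverges {X : Type} [MetricSpace X] (u : ℕ → X) (x : X) : Prop :=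
  ∀ (γ : ℝ → X) (L : ℝ), IsGeodesic γ L → γ 0 = x →
    ∀ ε > 0, ∀ᶠ n in Filter.atTop,
      ∀ q, IsClosestPoint (γ '' Set.Icc 0 L) (u n) q → dist q x < ε

/-- `A` contains all weak limits of bounded sequences of its elements. -/
def IsWeaklyClosed {X : Type} [MetricSpace X] (A : Set X) : Prop :=
  ∀ (u : ℕ → X) (x : X), (∀ n, u n ∈ A) → Bornology.IsBounded (Set.range u) →
    WeaklyConverges u x → x ∈ A

theorem WeaklyConverges.subseq {X : Type} [MetricSpace X] {u : ℕ → X} {x : X}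
    (h : WeaklyConverges u x) {φ : ℕ → ℕ} (hφ : StrictMono φ) :
    WeaklyConverges (u ∘ φ) x :=
  fun γ L hγ h0 ε hε => hφ.tendsto_atTop.eventually (h γ L hγ h0 ε hε)

theorem IsWeaklyClosed.union {X : Type} [MetricSpace X] {A B : Set X}
    (hA : IsWeaklyClosed A) (hB : IsWeaklyClosed B) : IsWeaklyClosed (A ∪ B) := by
  intro u x hu hb hx
  have key : ∀ C : Set X, IsWeaklyClosed C → (∃ᶠ n in Filter.atTop, u n ∈ C) → x ∈ C := by
    intro C hC hf
    obtain ⟨φ, hφ, hφC⟩ := Filter.extraction_of_frequently_atTop hf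
    exact hC (u ∘ φ) x hφC (hb.subset (Set.range_comp_subset_range φ u)) (hx.subseq hφ)
  have hf : ∃ᶠ n in Filter.atTop, u n ∈ A ∨ u n ∈ B :=
    Filter.Frequently.of_forall hu
  rcases Filter.frequently_or_distrib.1 hf with h | h
  · exact Or.inl (key A hA h)
  · exact Or.inr (key B hB h)

/-- The weak topology: its closed sets are the sets that contain all weak limits of bounded
sequences of their elements. -/
@[reducible]
def weakTopology (X : Type) [MetricSpace X] : TopologicalSpace X :=
  TopologicalSpace.ofClosed {A : Set X | IsWeaklyClosed A}
    (fun _ _ hu _ _ => (hu 0).elim)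
    (fun _ hS u x hu hb hx A hA => hS hA u x (fun n => hu n A hA) hb hx)
    (fun _ hA _ hB => hA.union hB)

/-- Geodesic convexity: together with two points, `C` contains every geodesic between them. -/
def IsGeodConvex {X : Type} [MetricSpace X] (C : Set X) : Prop :=
  ∀ x ∈ C, ∀ y ∈ C, ∀ z, MetricBetween x z y → z ∈ C

/-- The coconvex topology: the coarsest topology for which all metrically closed convex sets
are closed. -/
@[reducible]
def coconvexTopology (X : Type) [MetricSpace X] : TopologicalSpace X :=
  TopologicalSpace.generateFrom {U : Set X | IsClosed Uᶜ ∧ IsGeodConvex Uᶜ}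

/-! ### Gluing countably many copies of a pointed metric space at the base point -/

/-- The disjoint union of countably many copies of `Z`; its pseudometric below is the gluing
metric, for which the copies of `z` have distance zero. -/
structure PreWedge (Z : Type) (z : Z) where
  idx : ℕ
  pt : Z

noncomputable instance (Z : Type) [MetricSpace Z] (z : Z) :
    PseudoMetricSpace (PreWedge Z z) where
  dist a b := if a.idx = b.idx then dist a.pt b.pt else dist a.pt z + dist z b.pt
  dist_self a := by simp
  dist_comm a b := by
    by_cases h : a.idx = b.idx
    · rw [if_pos h, if_pos h.symm, dist_comm]
    · rw [if_neg h, if_neg (Ne.symm h), add_comm, dist_comm z, dist_comm a.pt]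
  dist_triangle a b c := by
    have h1 := dist_triangle a.pt b.pt c.pt
    have h2 := dist_triangle a.pt z c.pt
    have h3 := dist_triangle a.pt b.pt z
    have h4 := dist_triangle z b.pt c.pt
    have h5 : 0 ≤ dist b.pt z := dist_nonneg
    have h6 := dist_comm z b.pt
    split_ifs <;> first | linarith | (exfalso; omega)

/-- Countably many copies of `Z`, glued together at `z` by identifying the copies of `z`. -/
abbrev Wedge (Z : Type) [MetricSpace Z] (z : Z) : Type :=
  SeparationQuotient (PreWedge Z z)

/-- The point `x` of the `n`-th copy. -/
noncomputable def Wedge.mk {Z : Type} [MetricSpace Z] (z : Z) (n : ℕ) (x : Z) : Wedge Z z :=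
  SeparationQuotient.mk ⟨n, x⟩

/-! ### The Euclidean cone -/

/-- Pairs of a radius and a direction; for the pseudometric below, all pairs of radius zero
have distance zero. -/
structure PreCone (Y : Type) where
  rad : ℝ≥0
  dir : Y

/-- The third side of a planar triangle with sides `s`, `t` enclosing the angle `α`. -/
noncomputable def cosineSide (s t α : ℝ) : ℝ :=
  Real.sqrt (s ^ 2 + t ^ 2 - 2 * s * t * Real.cos α)

theorem cosineSide_planar (s u α β : ℝ) :
    cosineSide s u (α + β) =
      ‖(s : ℂ) * Complex.exp (α * Complex.I) - u * Complex.exp ((-β : ℝ) * Complex.I)‖ := by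
  rw [cosineSide, Complex.norm_def, Complex.normSq_apply]
  congr 1
  simp only [Complex.sub_re, Complex.sub_im, Complex.re_ofReal_mul, Complex.im_ofReal_mul,
    Complex.exp_ofReal_mul_I_re, Complex.exp_ofReal_mul_I_im, Real.cos_neg, Real.sin_neg,
    Real.cos_add]
  have h1 := Real.sin_sq_add_cos_sq α
  have h2 := Real.sin_sq_add_cos_sq β
  linear_combination (-s ^ 2) * h1 + (-u ^ 2) * h2

theorem cosineSide_triangle_planar (s t u α β : ℝ) :
    cosineSide s u (α + β) ≤ cosineSide s t α + cosineSide t u β := by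
  have h1 := cosineSide_planar s u α β
  have h2 := cosineSide_planar s t α 0
  have h3 := cosineSide_planar t u 0 β
  rw [add_zero] at h2
  rw [zero_add] at h3
  rw [h1, h2, h3]
  simp only [neg_zero, Complex.ofReal_zero, zero_mul, Complex.exp_zero, mul_one]
  exact norm_sub_le_norm_sub_add_norm_sub _ _ _

theorem cosineSide_mono {s t α β : ℝ} (hs : 0 ≤ s) (ht : 0 ≤ t) (hα : 0 ≤ α) (hβ : β ≤ Real.pi)
    (h : α ≤ β) : cosineSide s t α ≤ cosineSide s t β := by
  apply Real.sqrt_le_sqrt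
  have h1 := Real.cos_le_cos_of_nonneg_of_le_pi hα hβ h
  have h2 := mul_le_mul_of_nonneg_left h1 (mul_nonneg hs ht)
  linarith

theorem cosineSide_triangle {s t u α β γ : ℝ} (hs : 0 ≤ s) (ht : 0 ≤ t) (hu : 0 ≤ u)
    (hα' : α ≤ Real.pi) (hβ' : β ≤ Real.pi)
    (hγ : 0 ≤ γ) (hγ' : γ ≤ Real.pi) (h : γ ≤ α + β) :
    cosineSide s u γ ≤ cosineSide s t α + cosineSide t u β := by
  rcases le_total (α + β) Real.pi with h1 | h1
  · exact (cosineSide_mono hs hu hγ h1 h).trans (cosineSide_triangle_planar s t u α β)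
  · have h2 := cosineSide_triangle_planar s t u (Real.pi - β) β
    rw [sub_add_cancel] at h2
    have h3 := cosineSide_mono (s := s) (t := u) hs hu hγ le_rfl hγ'
    have h4 := cosineSide_mono (s := s) (t := t) (α := Real.pi - β) (β := α) hs ht
      (by linarith) hα' (by linarith)
    linarith

noncomputable instance (Y : Type) [MetricSpace Y] : PseudoMetricSpace (PreCone Y) where
  dist a b := cosineSide a.rad b.rad (min (dist a.dir b.dir) Real.pi)
  dist_self a := by
    have h : min 0 Real.pi = 0 := min_eq_left Real.pi_pos.le
    simp only [dist_self, h, cosineSide, Real.cos_zero]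
    rw [← Real.sqrt_zero]
    congr 1
    ring
  dist_comm a b := by
    simp only [dist_comm b.dir, cosineSide]
    congr 1
    ring
  dist_triangle a b c := by
    have hp := Real.pi_pos.le
    refine cosineSide_triangle a.rad.2 b.rad.2 c.rad.2 (min_le_right _ _)
      (min_le_right _ _) (le_min dist_nonneg hp) (min_le_right _ _) ?_
    have h1 := dist_triangle a.dir b.dir c.dir
    have h2 : 0 ≤ dist a.dir b.dir := dist_nonneg
    have h3 : 0 ≤ dist b.dir c.dir := dist_nonneg
    simp only [min_def]
    split_ifs <;> linarith

/-- The Euclidean cone over `Y`, with metric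
`d(s·x, t·y)² = s² + t² - 2 s t cos (min (d(x,y)) π)`. -/
abbrev EuclCone (Y : Type) [MetricSpace Y] : Type :=
  SeparationQuotient (PreCone Y)

/-- The point `r · y` on the ray in direction `y`, at distance `r` from the tip. -/
noncomputable def EuclCone.ray {Y : Type} [MetricSpace Y] (r : ℝ≥0) (y : Y) : EuclCone Y :=
  SeparationQuotient.mk ⟨r, y⟩

/-! ### The example -/

namespace Example

/-- The interval `[0, π/4]`. -/
abbrev Edge : Type := Set.Icc (0 : ℝ) (Real.pi / 4)

noncomputable def edgeStart : Edge := ⟨0, le_rfl, by positivity⟩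

noncomputable def edgeEnd : Edge := ⟨Real.pi / 4, by positivity, le_rfl⟩

/-- Countably many intervals `[0, π/4]`, glued together at `0`. -/
abbrev Y₁ : Type := Wedge Edge edgeStart

/-- The point of `Y₁` at which the intervals are glued. -/
noncomputable def centre : Y₁ := Wedge.mk edgeStart 0 edgeStart

/-- The countably many endpoints of `Y₁`. -/
noncomputable def endpt (k : ℕ) : Y₁ := Wedge.mk edgeStart k edgeEnd

/-- The tree: countably many copies of `Y₁`, glued together at the endpoint number `0`. -/
abbrev Y : Type := Wedge Y₁ (endpt 0)

/-- The point at which the copies of `Y₁` are glued. -/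
noncomputable def p : Y := Wedge.mk (endpt 0) 0 (endpt 0)

/-- The branching points different from `p`: the centres of the copies of `Y₁`. -/
noncomputable def b (n : ℕ) : Y := Wedge.mk (endpt 0) n centre

/-- The far ends of the edges of `Y` at `b n`. For `k = 0` this is `p`, for `k ≥ 1` it is an
endpoint of `Y`. The edges of `Y` are the segments from `b n` to `e n k`. -/
noncomputable def e (n k : ℕ) : Y := Wedge.mk (endpt 0) n (endpt k)

/-- The tip of the cone over `Y`. -/
noncomputable def o : EuclCone Y := EuclCone.ray 0 p

/-- The solid triangle with vertices `o`, `2·y`, `2·y'`: the union of the segments from `o` to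
the points of the segment from `2·y` to `2·y'`. -/
def triangle (y y' : Y) : Set (EuclCone Y) :=
  {z | ∃ w, MetricBetween (EuclCone.ray 2 y) w (EuclCone.ray 2 y') ∧ MetricBetween o z w}

/-- The union of the triangles over all edges of `Y`. As a type it carries the metric of the
cone. -/
def X : Set (EuclCone Y) := ⋃ (n : ℕ) (k : ℕ), triangle (b n) (e n k)

/-- The branching points of `Y` different from `p`. -/
def B : Set Y := {y | ∃ n, y = b n}

/-- The endpoints of `Y`. -/
def E : Set Y := {y | ∃ n k, 1 ≤ k ∧ y = e n k}

/-- The set `E ∪ (1/√2)·B ∪ {(1/2)·p} ∪ {o}`, where `Y` is identified with the unit sphere of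
the cone. -/
noncomputable def A : Set (EuclCone Y) :=
  EuclCone.ray 1 '' E ∪ EuclCone.ray (1 / NNReal.sqrt 2) '' B ∪ {EuclCone.ray (1 / 2) p} ∪ {o}

end Example

/-! ### Barycentres and the CAT(0) condition -/

/-! CAT(0) is reduced to a quadratic inequality: every pair of points and every ratio should have a
point `m` satisfying Stewart's identity as an inequality against all test points (`HasBarycentres`).
This yields geodesics, their uniqueness, and thin triangles.

In a cone over a tree of diameter at most `π`, the path between two directions spans a planar
sector, and `m` is the Euclidean division point in it. A test point whose direction branches off
that path can be unfolded into the plane; unfolding only increases its distance to the endpoint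
beyond the branching (`EuclCone.isBarycentre_ray`). `X` is cut out of the cone by two inequalities
depending on `d(p, ·)` alone. The same unfolding shows that they survive on segments
(`exists_isBarycentre_inRegion`), so `X` inherits the barycentres; it is also complete.

Weak limits are asymptotic centres: no point is closer by a fixed amount to infinitely many `u n`
than the weak limit is. Infinitely many endpoints on different edges at one `b n` favour the foot
`(1/√2)·b n`, infinitely many points `(1/√2)·b n` in different copies favour `(1/2)·p`, and
endpoints in different copies favour `o`. All these points were put into `A`, so no weak limit lies
outside `A` (`isWeaklyClosed_A`).

For the coconvex topology, suppose finitely many convex sets cover `A`. By pigeonhole one of them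
contains two endpoints from each of two copies of `Y₁`. Convexity then forces into it the two points
`(1/√2)·b`, their midpoint `(1/2)·p`, the tip `o`, and hence `(1/4)·p`
(`quarterPoint_mem_of_convex`). So `(1/4)·p` cannot be separated from `A`. -/

/-- `m` satisfies the CAT(0) comparison inequality for the point dividing a segment from `q` to
`r` in the ratio `t : 1 - t`. -/
def IsBarycentre {X : Type} [MetricSpace X] (t : ℝ) (q r m : X) : Prop :=
  ∀ p, dist p m ^ 2 ≤ (1 - t) * dist p q ^ 2 + t * dist p r ^ 2 - t * (1 - t) * dist q r ^ 2

/-- Tested at `m'`, the right-hand side vanishes. Hence points on geodesics are unique, and any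
point with the right two distances inherits the inequality. -/
theorem IsBarycentre.eq_of_dist {X : Type} [MetricSpace X] {t : ℝ} {q r m m' : X}
    (h : IsBarycentre t q r m) (h1 : dist q m' = t * dist q r)
    (h2 : dist m' r = (1 - t) * dist q r) : m' = m := by
  have h3 := h m'
  rw [dist_comm m' q, h1, h2] at h3
  have h4 : dist m' m ^ 2 ≤ 0 := h3.trans_eq (by ring)
  exact dist_eq_zero.1 (by nlinarith [dist_nonneg (x := m') (y := m)])

/-- Testing at `q` and at `r` gives upper bounds with sum `dist q r`; the triangle inequality makes
both sharp. -/
theorem IsBarycentre.dist_left {X : Type} [MetricSpace X] {t : ℝ} {q r m : X}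
    (h : IsBarycentre t q r m) (ht : t ∈ Set.Icc (0 : ℝ) 1) :
    dist q m = t * dist q r ∧ dist m r = (1 - t) * dist q r := by
  have hd : 0 ≤ dist q r := dist_nonneg
  have h1 : dist q m ≤ t * dist q r := by
    refine abs_le_of_sq_le_sq' ?_ (mul_nonneg ht.1 hd) |>.2
    have := h q
    rw [dist_self] at this
    exact this.trans_eq (by ring)
  have h2 : dist m r ≤ (1 - t) * dist q r := by
    refine abs_le_of_sq_le_sq' ?_ (mul_nonneg (sub_nonneg.2 ht.2) hd) |>.2
    have := h r
    rw [dist_self, dist_comm r m, dist_comm r q] at this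
    exact this.trans_eq (by ring)
  have h3 := dist_triangle q m r
  constructor <;> linarith

theorem MetricBetween.exists_ratio {X : Type} [MetricSpace X] {q m r : X}
    (h : MetricBetween q m r) :
    ∃ t ∈ Set.Icc (0 : ℝ) 1, dist q m = t * dist q r ∧ dist m r = (1 - t) * dist q r := by
  unfold MetricBetween at h
  have h1 : 0 ≤ dist q m := dist_nonneg
  have h2 : 0 ≤ dist m r := dist_nonneg
  rcases eq_or_ne (dist q r) 0 with h0 | h0
  · exact ⟨0, by simp, by rw [h0]; linarith, by rw [h0]; linarith⟩
  · have h3 : 0 < dist q r := lt_of_le_of_ne dist_nonneg h0.symm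
    refine ⟨dist q m / dist q r, ⟨by positivity, ?_⟩, by field_simp, ?_⟩
    · rw [div_le_one h3]; linarith
    · field_simp; linarith

/-- Every ratio on every pair of points is realized by a barycentre. -/
def HasBarycentres (X : Type) [MetricSpace X] : Prop :=
  ∀ q r : X, ∀ t ∈ Set.Icc (0 : ℝ) 1, ∃ m, IsBarycentre t q r m

theorem HasBarycentres.isBarycentre {X : Type} [MetricSpace X] (hX : HasBarycentres X) {t : ℝ}
    {q r m : X} (ht : t ∈ Set.Icc (0 : ℝ) 1) (h1 : dist q m = t * dist q r)
    (h2 : dist m r = (1 - t) * dist q r) : IsBarycentre t q r m := by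
  obtain ⟨m', hm'⟩ := hX q r t ht
  rwa [hm'.eq_of_dist h1 h2]

theorem HasBarycentres.exists_geodesic {X : Type} [MetricSpace X] (hX : HasBarycentres X)
    (x y : X) : ∃ γ : ℝ → X, IsGeodesic γ (dist x y) ∧ γ 0 = x ∧ γ (dist x y) = y := by
  rcases eq_or_ne x y with rfl | hxy
  · refine ⟨fun _ => x, ⟨by simp, ?_⟩, rfl, rfl⟩
    intro s hs t ht
    rw [dist_self] at hs ht
    have h1 := le_antisymm hs.2 hs.1
    have h2 := le_antisymm ht.2 ht.1
    simp [h1, h2]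
  set L := dist x y with hL
  have hL0 : 0 < L := dist_pos.2 hxy
  have key : ∀ s : ℝ, ∃ m, s ∈ Set.Icc 0 L → IsBarycentre (s / L) x y m := by
    intro s
    by_cases hs : s ∈ Set.Icc 0 L
    · obtain ⟨m, hm⟩ := hX x y (s / L) ⟨div_nonneg hs.1 hL0.le, (div_le_one hL0).2 hs.2⟩
      exact ⟨m, fun _ => hm⟩
    -- Outside `[0, L]` the value of the path is irrelevant.
    · exact ⟨x, fun h => (hs h).elim⟩
  choose γ hγ using key
  have hd : ∀ s ∈ Set.Icc 0 L, dist x (γ s) = s ∧ dist (γ s) y = L - s := by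
    intro s hs
    obtain ⟨h1, h2⟩ := (hγ s hs).dist_left ⟨div_nonneg hs.1 hL0.le, (div_le_one hL0).2 hs.2⟩
    rw [← hL] at h1 h2
    constructor
    · rw [h1]; field_simp
    · rw [h2]; field_simp
  have h0 : (0 : ℝ) ∈ Set.Icc 0 L := ⟨le_rfl, hL0.le⟩
  have h1 : L ∈ Set.Icc 0 L := ⟨hL0.le, le_rfl⟩
  refine ⟨γ, ⟨hL0.le, ?_⟩, (dist_eq_zero.1 (hd 0 h0).1).symm, dist_eq_zero.1 ?_⟩
  · intro s hs t ht
    apply le_antisymm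
    -- The barycentre `γ t` tested at `γ s` gives exactly `(s - t)²`.
    · have h := hγ t ht (γ s)
      rw [dist_comm (γ s) x, (hd s hs).1, (hd s hs).2, ← hL] at h
      rw [← abs_of_nonneg (dist_nonneg (x := γ s) (y := γ t))]
      refine sq_le_sq.1 (h.trans_eq ?_)
      field_simp
      ring
    · rw [abs_le']
      have h2 := dist_triangle x (γ s) (γ t)
      have h3 := dist_triangle x (γ t) (γ s)
      rw [(hd s hs).1, (hd t ht).1] at h2
      rw [(hd s hs).1, (hd t ht).1, dist_comm] at h3
      constructor <;> linarith
  · rw [(hd L h1).2, sub_self]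

theorem dist_sq_lineMap {V : Type} [NormedAddCommGroup V] [InnerProductSpace ℝ V]
    (t : ℝ) (p q r : V) :
    dist p (q + t • (r - q)) ^ 2 =
      (1 - t) * dist p q ^ 2 + t * dist p r ^ 2 - t * (1 - t) * dist q r ^ 2 := by
  have h1 : p - (q + t • (r - q)) = (p - q) - t • (r - q) := by abel
  have h2 : p - r = (p - q) - (r - q) := by abel
  rw [dist_comm q r]
  simp only [dist_eq_norm]
  rw [h1, h2, norm_sub_sq_real (p - q), norm_sub_sq_real (p - q), inner_smul_right,
    norm_smul, mul_pow, Real.norm_eq_abs, sq_abs]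
  ring

theorem dist_sq_of_ratio {V : Type} [NormedAddCommGroup V] [InnerProductSpace ℝ V]
    {t : ℝ} {q r m : V} (h1 : dist q m = t * dist q r) (h2 : dist m r = (1 - t) * dist q r)
    (p : V) : dist p m ^ 2 =
      (1 - t) * dist p q ^ 2 + t * dist p r ^ 2 - t * (1 - t) * dist q r ^ 2 := by
  have h : IsBarycentre t q r (q + t • (r - q)) := fun p => (dist_sq_lineMap t p q r).le
  rw [h.eq_of_dist h1 h2, dist_sq_lineMap]

/-- The inequality is used twice, for `x` on `[p,q]` against `r` and then for `y` on `[p,r]` against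
`x`. In the plane both are equalities with the same data. -/
theorem HasBarycentres.isCAT0 {X : Type} [MetricSpace X] [hc : CompleteSpace X]
    (hX : HasBarycentres X) : IsCAT0 X where
  complete := hc
  geodesic := hX.exists_geodesic
  thin := by
    intro p q r x y p' q' r' x' y' hpq hqr hpr hx hpx hxq hy hpy hyr
    obtain ⟨s, hs, hs1, hs2⟩ := hx.exists_ratio
    obtain ⟨t, ht, ht1, ht2⟩ := hy.exists_ratio
    have e1 := dist_sq_of_ratio (t := s) (q := p') (r := q') (m := x')
      (by rw [hpx, hpq, hs1]) (by rw [hxq, hpq, hs2]) r'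
    have e2 := dist_sq_of_ratio (t := t) (q := p') (r := r') (m := y')
      (by rw [hpy, hpr, ht1]) (by rw [hyr, hpr, ht2]) x'
    have i1 := hX.isBarycentre hs hs1 hs2 r
    have i2 := hX.isBarycentre ht ht1 ht2 x
    rw [dist_comm x' r', dist_comm x' p', e1, hpx, dist_comm r' p', dist_comm r' q', hpr, hqr,
      hpq] at e2
    rw [dist_comm x r, dist_comm x p] at i2
    rw [dist_comm r p, dist_comm r q] at i1
    refine (sq_le_sq₀ dist_nonneg dist_nonneg).1 ?_
    rw [e2]
    refine i2.trans ?_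
    have := mul_le_mul_of_nonneg_left i1 ht.1
    linarith

/-! ### Weak convergence -/

/-- The projection of `u n` to the geodesic from `x` to `z` is no farther from `u n` than `z` is,
and it is eventually within `ε` of `x`. -/
theorem WeaklyConverges.eventually_dist_le {X : Type} [MetricSpace X] (hX : HasBarycentres X)
    {u : ℕ → X} {x : X} (h : WeaklyConverges u x) (z : X) {ε : ℝ} (hε : 0 < ε) :
    ∀ᶠ n in Filter.atTop, dist (u n) x < dist (u n) z + ε := by
  obtain ⟨γ, hγ, h0, h1⟩ := hX.exists_geodesic x z
  have hcont : ContinuousOn γ (Set.Icc 0 (dist x z)) := by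
    have : LipschitzOnWith 1 γ (Set.Icc 0 (dist x z)) := by
      refine LipschitzOnWith.of_dist_le_mul fun s hs t ht => ?_
      rw [hγ.2 s hs t ht, Real.dist_eq]
      simp
    exact this.continuousOn
  have hcpt : IsCompact (γ '' Set.Icc 0 (dist x z)) := isCompact_Icc.image_of_continuousOn hcont
  have hz : z ∈ γ '' Set.Icc 0 (dist x z) := ⟨_, ⟨dist_nonneg, le_rfl⟩, h1⟩
  filter_upwards [h γ _ hγ h0 ε hε] with n hn
  obtain ⟨q, hq, hmin⟩ := hcpt.exists_isMinOn ⟨z, hz⟩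
    (continuous_const.dist continuous_id : Continuous fun w => dist (u n) w).continuousOn
  have h2 := hn q ⟨hq, fun w hw => hmin hw⟩
  have h3 : dist (u n) q ≤ dist (u n) z := hmin hz
  have h4 := dist_triangle (u n) q x
  linarith

/-! ### Metric trees -/

/-- Any two points are joined by a path from which the distance to any point `x` is the distance
`h` to the path plus the distance along the path to the foot point `w` of `x`. -/
def IsMetricTree (Z : Type) [MetricSpace Z] : Prop :=
  ∀ y y' : Z, ∃ c : ℝ → Z, c 0 = y ∧ c (dist y y') = y' ∧
    ∀ x, ∃ h w : ℝ, 0 ≤ h ∧ w ∈ Set.Icc 0 (dist y y') ∧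
      ∀ φ ∈ Set.Icc 0 (dist y y'), dist x (c φ) = h + |φ - w|

theorem isMetricTree_Icc (a b : ℝ) : IsMetricTree (Set.Icc a b) := by
  have key : ∀ y y' : Set.Icc a b, y ≤ y' → ∃ c : ℝ → Set.Icc a b, c 0 = y ∧
      c (dist y y') = y' ∧ ∀ x, ∃ h w : ℝ, 0 ≤ h ∧ w ∈ Set.Icc 0 (dist y y') ∧
      ∀ φ ∈ Set.Icc 0 (dist y y'), dist x (c φ) = h + |φ - w| := by
    rintro ⟨y, hy⟩ ⟨y', hy'⟩ hle
    have hle' : y ≤ y' := hle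
    have hd : dist (⟨y, hy⟩ : Set.Icc a b) ⟨y', hy'⟩ = y' - y := by
      rw [Subtype.dist_eq, Real.dist_eq, abs_sub_comm, abs_of_nonneg (sub_nonneg.2 hle')]
    rw [hd]
    have hab : a ≤ b := hy.1.trans hy.2
    have hc : ∀ φ ∈ Set.Icc 0 (y' - y),
        ((Set.projIcc a b hab (y + φ) : Set.Icc a b) : ℝ) = y + φ := fun φ hφ => by
      rw [Set.projIcc_of_mem hab ⟨by linarith [hφ.1, hy.1], by linarith [hφ.2, hy'.2]⟩]
    refine ⟨fun φ => Set.projIcc a b hab (y + φ), ?_, ?_, ?_⟩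
    · apply Subtype.ext
      rw [hc 0 ⟨le_rfl, sub_nonneg.2 hle'⟩, add_zero]
    · apply Subtype.ext
      rw [hc _ ⟨sub_nonneg.2 hle', le_rfl⟩]
      ring
    · rintro ⟨x, hx⟩
      rcases le_total x y with h1 | h1
      · refine ⟨y - x, 0, by linarith, ⟨le_rfl, by linarith⟩, fun φ hφ => ?_⟩
        rw [Subtype.dist_eq, Real.dist_eq, hc φ hφ, sub_zero, abs_of_nonneg hφ.1,
          abs_sub_comm, abs_of_nonneg (by linarith [hφ.1])]
        ring
      rcases le_total x y' with h2 | h2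
      · refine ⟨0, x - y, le_rfl, ⟨by linarith, by linarith⟩, fun φ hφ => ?_⟩
        rw [Subtype.dist_eq, Real.dist_eq, hc φ hφ, abs_sub_comm, zero_add]
        congr 1
        ring
      · refine ⟨x - y', y' - y, by linarith, ⟨by linarith, le_rfl⟩, fun φ hφ => ?_⟩
        rw [Subtype.dist_eq, Real.dist_eq, hc φ hφ, abs_of_nonneg (by linarith [hφ.2]),
          abs_sub_comm, abs_of_nonneg (by linarith [hφ.2])]
        ring
  intro y y'
  rcases le_total y y' with h | h
  · exact key y y' h
  · obtain ⟨c, h0, h1, h2⟩ := key y' y h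
    rw [dist_comm y y']
    refine ⟨fun φ => c (dist y' y - φ), by simpa using h1, by simpa using h0, fun x => ?_⟩
    obtain ⟨k, w, hk, hw, H⟩ := h2 x
    refine ⟨k, dist y' y - w, hk, ⟨by linarith [hw.2], by linarith [hw.1]⟩, fun φ hφ => ?_⟩
    rw [H _ ⟨by linarith [hφ.2], by linarith [hφ.1]⟩, abs_sub_comm]
    congr 2
    ring

namespace Wedge

variable {Z : Type} [MetricSpace Z] {z : Z}

theorem dist_mk (m n : ℕ) (x y : Z) :
    dist (mk z m x) (mk z n y) = if m = n then dist x y else dist x z + dist z y := by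
  unfold mk
  rw [SeparationQuotient.dist_mk]
  rfl

theorem dist_mk_same (n : ℕ) (x y : Z) : dist (mk z n x) (mk z n y) = dist x y := by
  rw [dist_mk, if_pos rfl]

theorem dist_mk_of_ne {m n : ℕ} (h : m ≠ n) (x y : Z) :
    dist (mk z m x) (mk z n y) = dist x z + dist z y := by
  rw [dist_mk, if_neg h]

theorem mk_base (m n : ℕ) : mk z m z = mk z n z := by
  rw [← dist_eq_zero, dist_mk]
  simp

theorem dist_base (m n : ℕ) (x : Z) : dist (mk z m x) (mk z n z) = dist x z := by
  rw [mk_base n m, dist_mk_same]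

theorem exists_mk (a : Wedge Z z) : ∃ n x, a = mk z n x := by
  obtain ⟨⟨n, x⟩, rfl⟩ := SeparationQuotient.surjective_mk a
  exact ⟨n, x, rfl⟩

/-- Paths between different copies are concatenated at `z`. The foot of a point in a third copy is
`z`; if the path stays in one copy, a point of another copy has the same foot as `z`. -/
theorem isMetricTree (hZ : IsMetricTree Z) : IsMetricTree (Wedge Z z) := by
  intro a a'
  obtain ⟨m, y, rfl⟩ := exists_mk a
  obtain ⟨n, y', rfl⟩ := exists_mk a'
  by_cases hmn : m = n
  · subst hmn
    rw [dist_mk_same]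
    obtain ⟨c, h0, h1, h2⟩ := hZ y y'
    refine ⟨fun φ => mk z m (c φ), congrArg _ h0, congrArg _ h1, fun x => ?_⟩
    obtain ⟨k, x, rfl⟩ := exists_mk x
    by_cases hk : k = m
    · subst hk
      obtain ⟨h, w, hh, hw, H⟩ := h2 x
      exact ⟨h, w, hh, hw, fun φ hφ => by rw [dist_mk_same, H φ hφ]⟩
    · obtain ⟨h, w, hh, hw, H⟩ := h2 z
      refine ⟨dist x z + h, w, add_nonneg dist_nonneg hh, hw, fun φ hφ => ?_⟩
      rw [dist_mk_of_ne hk, H φ hφ, add_assoc]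
  · rw [dist_mk_of_ne hmn]
    obtain ⟨c, h0, h1, h2⟩ := hZ y z
    obtain ⟨c', h0', h1', h2'⟩ := hZ z y'
    have ha : 0 ≤ dist y z := dist_nonneg
    have hb : 0 ≤ dist z y' := dist_nonneg
    have hc' : ∀ φ, ¬ φ ≤ dist y z → φ ∈ Set.Icc 0 (dist y z + dist z y') →
        φ - dist y z ∈ Set.Icc 0 (dist z y') := fun φ h1 h2 =>
      ⟨by linarith, by linarith [h2.2]⟩
    have hdc : ∀ φ ∈ Set.Icc 0 (dist y z), dist (c φ) z = dist y z - φ := by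
      intro φ hφ
      obtain ⟨h, w, hh, hw, H⟩ := h2 z
      have e1 := H _ ⟨ha, le_rfl⟩
      rw [h1, dist_self] at e1
      have e2 : |dist y z - w| = 0 := le_antisymm (by linarith) (abs_nonneg _)
      have e3 := abs_eq_zero.1 e2
      rw [dist_comm, H φ hφ, abs_sub_comm, abs_of_nonneg (by linarith [hφ.2])]
      linarith
    have hdc' : ∀ φ ∈ Set.Icc 0 (dist z y'), dist z (c' φ) = φ := by
      intro φ hφ
      obtain ⟨h, w, hh, hw, H⟩ := h2' z
      have e1 := H _ ⟨le_rfl, hb⟩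
      rw [h0', dist_self] at e1
      have e2 : |0 - w| = 0 := le_antisymm (by linarith) (abs_nonneg _)
      have e3 := abs_eq_zero.1 e2
      rw [H φ hφ, abs_of_nonneg (by linarith [hφ.1])]
      linarith
    refine ⟨fun φ => if φ ≤ dist y z then mk z m (c φ) else mk z n (c' (φ - dist y z)),
      by simp only [if_pos ha]; rw [h0], ?_, fun x => ?_⟩
    -- The final parameter falls into the first branch only if `y' = z`.
    · by_cases h : dist y z + dist z y' ≤ dist y z
      · have hz : dist z y' = 0 := by linarith
        simp only [hz, add_zero, le_rfl, if_true]
        rw [h1, dist_eq_zero.1 hz, mk_base m n]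
      · simp only [if_neg h, add_sub_cancel_left]
        rw [h1']
    · obtain ⟨k, x, rfl⟩ := exists_mk x
      by_cases hkm : k = m
      · subst hkm
        obtain ⟨h, w, hh, hw, H⟩ := h2 x
        have e1 := H _ ⟨ha, le_rfl⟩
        rw [h1, abs_of_nonneg (by linarith [hw.2])] at e1
        refine ⟨h, w, hh, ⟨hw.1, by linarith [hw.2]⟩, fun φ hφ => ?_⟩
        by_cases hc : φ ≤ dist y z
        · simp only [if_pos hc, dist_mk_same]
          exact H φ ⟨hφ.1, hc⟩
        · simp only [if_neg hc]
          rw [dist_mk_of_ne hmn, hdc' _ (hc' φ hc hφ), e1,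
            abs_of_nonneg (a := φ - w) (by linarith [hw.2])]
          ring
      · by_cases hkn : k = n
        · subst hkn
          obtain ⟨h, w, hh, hw, H⟩ := h2' x
          have e1 := H _ ⟨le_rfl, hb⟩
          rw [h0', abs_sub_comm, abs_of_nonneg (by linarith [hw.1])] at e1
          refine ⟨h, dist y z + w, hh, ⟨by linarith [hw.1], by linarith [hw.2]⟩,
            fun φ hφ => ?_⟩
          by_cases hc : φ ≤ dist y z
          · simp only [if_pos hc]
            rw [dist_mk_of_ne hkm, dist_comm z, hdc φ ⟨hφ.1, hc⟩, e1, abs_sub_comm φ,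
              abs_of_nonneg (a := dist y z + w - φ) (by linarith [hw.1])]
            ring
          · simp only [if_neg hc]
            rw [dist_mk_same, H _ (hc' φ hc hφ), sub_sub]
        · refine ⟨dist x z, dist y z, dist_nonneg, ⟨ha, by linarith⟩, fun φ hφ => ?_⟩
          by_cases hc : φ ≤ dist y z
          · simp only [if_pos hc]
            rw [dist_mk_of_ne hkm, dist_comm z, hdc φ ⟨hφ.1, hc⟩, abs_sub_comm,
              abs_of_nonneg (by linarith)]
          · simp only [if_neg hc]
            rw [dist_mk_of_ne hkn, hdc' _ (hc' φ hc hφ), abs_of_nonneg (by linarith)]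

/-- A Cauchy sequence returning arbitrarily close to the gluing point converges to it. Otherwise it
stays `ε` away, where different copies are at least `ε` apart, so it ends in a single copy. -/
theorem completeSpace [CompleteSpace Z] : CompleteSpace (Wedge Z z) := by
  refine Metric.complete_of_cauchySeq_tendsto fun u hu => ?_
  set o : Wedge Z z := mk z 0 z with ho
  by_cases h : ∀ ε > 0, ∀ N, ∃ n ≥ N, dist (u n) o < ε
  · refine ⟨o, Metric.tendsto_atTop.2 fun ε hε => ?_⟩
    obtain ⟨N, hN⟩ := Metric.cauchySeq_iff.1 hu (ε / 2) (half_pos hε)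
    obtain ⟨m, hm, hmo⟩ := h (ε / 2) (half_pos hε) N
    refine ⟨N, fun n hn => ?_⟩
    have h1 := hN n hn m hm
    have h2 := dist_triangle (u n) (u m) o
    linarith
  · push Not at h
    obtain ⟨ε, hε, N, hN⟩ := h
    obtain ⟨N', hN'⟩ := Metric.cauchySeq_iff.1 hu ε hε
    obtain ⟨i, x₀, hi⟩ := exists_mk (u (max N N'))
    have hmem : ∀ n, u (n + max N N') ∈ Set.range (mk z i) := by
      intro n
      obtain ⟨j, x, hj⟩ := exists_mk (u (n + max N N'))
      have hle : max N N' ≤ n + max N N' := Nat.le_add_left _ _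
      have h1 := hN' _ ((le_max_right N N').trans hle) _ (le_max_right N N')
      have h2 := hN _ ((le_max_left N N').trans hle)
      by_cases hji : j = i
      · exact ⟨x, by rw [hj, hji]⟩
      · rw [hi, hj, dist_mk_of_ne hji] at h1
        rw [hj, ho, dist_base] at h2
        linarith [dist_nonneg (x := z) (y := x₀)]
    have hiso : Isometry (mk z i) := Isometry.of_dist_eq fun x y => dist_mk_same i x y
    have hcomp : IsComplete (Set.range (mk z i)) := hiso.isUniformInducing.isComplete_range
    obtain ⟨v, -, hv⟩ := cauchySeq_tendsto_of_isComplete hcomp hmem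
      (hu.comp_tendsto (Filter.tendsto_add_atTop_nat _))
    exact ⟨v, (Filter.tendsto_add_atTop_iff_nat _).1 hv⟩

end Wedge

/-! ### Cones over metric trees of diameter at most `π` -/

theorem cosineSide_arg_nonneg (s t α : ℝ) : 0 ≤ s ^ 2 + t ^ 2 - 2 * s * t * Real.cos α := by
  have h1 := Real.sin_sq_add_cos_sq α
  nlinarith [sq_nonneg (s - t * Real.cos α), sq_nonneg (t * Real.sin α)]

/-- The planar point dividing the segment between the points with polar coordinates `(s, 0)` and
`(r, α)` in the ratio `t : 1 - t` has polar coordinates `(m, φ)` with `0 ≤ φ ≤ α`. -/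
theorem exists_polar_segment {s r t α : ℝ} (hs : 0 ≤ s) (hr : 0 ≤ r)
    (ht : t ∈ Set.Icc (0 : ℝ) 1) (hα : 0 ≤ α) (hα' : α ≤ Real.pi) :
    ∃ m φ : ℝ, 0 ≤ m ∧ φ ∈ Set.Icc 0 α ∧
      ∀ β, m * Real.cos (φ - β) = (1 - t) * (s * Real.cos β) + t * (r * Real.cos (α - β)) := by
  have h1t : 0 ≤ 1 - t := sub_nonneg.2 ht.2
  set a : ℝ := (1 - t) * s + t * (r * Real.cos α) with ha
  set b : ℝ := t * (r * Real.sin α) with hb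
  have hsin : 0 ≤ Real.sin α := Real.sin_nonneg_of_nonneg_of_le_pi hα hα'
  have hb0 : 0 ≤ b := mul_nonneg ht.1 (mul_nonneg hr hsin)
  set ζ : ℂ := ⟨a, b⟩ with hζ
  have hre : ‖ζ‖ * Real.cos ζ.arg = a := Complex.norm_mul_cos_arg ζ
  have him : ‖ζ‖ * Real.sin ζ.arg = b := Complex.norm_mul_sin_arg ζ
  have key : ∀ m φ : ℝ, m * Real.cos φ = a → m * Real.sin φ = b → ∀ β,
      m * Real.cos (φ - β) =
        (1 - t) * (s * Real.cos β) + t * (r * Real.cos (α - β)) := by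
    intro m φ h1 h2 β
    rw [Real.cos_sub, Real.cos_sub]
    linear_combination Real.cos β * h1 + Real.sin β * h2
  by_cases hζ0 : ζ = 0
  · have ha0 : a = 0 := congrArg Complex.re hζ0
    have hb0 : b = 0 := congrArg Complex.im hζ0
    exact ⟨0, 0, le_rfl, ⟨le_rfl, hα⟩, key 0 0 (by rw [ha0, zero_mul]) (by rw [hb0, zero_mul])⟩
  refine ⟨‖ζ‖, ζ.arg, norm_nonneg _, ⟨Complex.arg_nonneg_iff.2 hb0, ?_⟩, key _ _ hre him⟩
  -- If the argument exceeded `α`, the sign of the sine would leave only `α = 0` and argument `π`,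
  -- which is excluded by `a ≥ 0`.
  by_contra! hlt
  have hpos : 0 < ‖ζ‖ := norm_pos_iff.2 hζ0
  have hpi := Complex.arg_le_pi ζ
  have h1 : 0 ≤ Real.sin (ζ.arg - α) :=
    Real.sin_nonneg_of_nonneg_of_le_pi (by linarith) (by linarith)
  have h2 : ‖ζ‖ * Real.sin (ζ.arg - α) = -((1 - t) * s * Real.sin α) := by
    rw [Real.sin_sub]
    linear_combination Real.cos α * him - Real.sin α * hre
  have h3 : 0 ≤ (1 - t) * s * Real.sin α := mul_nonneg (mul_nonneg h1t hs) hsin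
  have h4 : Real.sin (ζ.arg - α) = 0 := by
    have := mul_nonneg hpos.le h1
    have h5 : ‖ζ‖ * Real.sin (ζ.arg - α) = 0 := by linarith
    exact (mul_eq_zero.1 h5).resolve_left hpos.ne'
  have h5 : ¬ ζ.arg - α < Real.pi := fun h =>
    (Real.sin_pos_of_pos_of_lt_pi (by linarith) h).ne' h4
  have hα0 : α = 0 := by linarith
  have harg : ζ.arg = Real.pi := by linarith
  rw [harg, Real.cos_pi] at hre
  rw [hα0, Real.cos_zero] at ha
  have h6 : 0 ≤ a := by
    rw [ha]
    exact add_nonneg (mul_nonneg h1t hs) (mul_nonneg ht.1 (by linarith))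
  linarith

namespace EuclCone

variable {Y : Type} [MetricSpace Y]

theorem exists_ray (z : EuclCone Y) : ∃ s y, z = ray s y := by
  obtain ⟨⟨s, y⟩, rfl⟩ := SeparationQuotient.surjective_mk z
  exact ⟨s, y, rfl⟩

theorem dist_ray (hY : ∀ x y : Y, dist x y ≤ Real.pi) (s t : ℝ≥0) (x y : Y) :
    dist (ray s x) (ray t y) = cosineSide s t (dist x y) := by
  have h : dist (ray s x) (ray t y) = cosineSide s t (min (dist x y) Real.pi) := by
    unfold ray
    rw [SeparationQuotient.dist_mk]
    rfl
  rw [h, min_eq_left (hY x y)]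

theorem dist_ray_sq (hY : ∀ x y : Y, dist x y ≤ Real.pi) (s t : ℝ≥0) (x y : Y) :
    dist (ray s x) (ray t y) ^ 2 =
      (s : ℝ) ^ 2 + (t : ℝ) ^ 2 - 2 * s * t * Real.cos (dist x y) := by
  rw [dist_ray hY, cosineSide, Real.sq_sqrt (cosineSide_arg_nonneg _ _ _)]

theorem dist_ray_zero (hY : ∀ x y : Y, dist x y ≤ Real.pi) (s : ℝ≥0) (x y : Y) :
    dist (ray s x) (ray 0 y) = s := by
  rw [dist_ray hY, cosineSide]
  simp

theorem ray_zero (hY : ∀ x y : Y, dist x y ≤ Real.pi) (x y : Y) : ray 0 x = ray 0 y := by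
  rw [← dist_eq_zero, dist_ray_zero hY]
  rfl

/-- The squared-distance inequality reduces to one between inner products with the test direction,
where `hm` is the planar identity for every direction `β`. -/
theorem isBarycentre_ray (hY : ∀ x y : Y, dist x y ≤ Real.pi) {y y' : Y} {c : ℝ → Y}
    (hc0 : c 0 = y) (hc1 : c (dist y y') = y')
    (hc : ∀ x, ∃ h w : ℝ, 0 ≤ h ∧ w ∈ Set.Icc 0 (dist y y') ∧
      ∀ φ ∈ Set.Icc 0 (dist y y'), dist x (c φ) = h + |φ - w|)
    {s r m : ℝ≥0} {t φ : ℝ} (ht : t ∈ Set.Icc (0 : ℝ) 1) (hφ : φ ∈ Set.Icc 0 (dist y y'))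
    (hm : ∀ β, m * Real.cos (φ - β) =
      (1 - t) * (s * Real.cos β) + t * (r * Real.cos (dist y y' - β))) :
    IsBarycentre t (ray s y) (ray r y') (ray m (c φ)) := by
  intro P
  obtain ⟨σ, x, rfl⟩ := exists_ray P
  obtain ⟨h, w, hh, hw, H⟩ := hc x
  have hα := hY y y'
  have hα0 : 0 ≤ dist y y' := dist_nonneg
  have d0 := H 0 ⟨le_rfl, hα0⟩
  have d1 := H _ ⟨hα0, le_rfl⟩
  rw [hc0, zero_sub, abs_neg, abs_of_nonneg hw.1] at d0
  rw [hc1, abs_of_nonneg (sub_nonneg.2 hw.2)] at d1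
  rw [dist_ray_sq hY, dist_ray_sq hY, dist_ray_sq hY, dist_ray_sq hY, H φ hφ, d0, d1]
  have hhpi : h ≤ Real.pi := by linarith [hY x y, hw.1]
  have hsh := Real.sin_nonneg_of_nonneg_of_le_pi hh hhpi
  -- The directions `0` and `π/2` give Cartesian coordinates, hence the norm of the planar point.
  have e0 := hm 0
  have e1 := hm (Real.pi / 2)
  simp only [Real.cos_sub_pi_div_two, sub_zero, Real.cos_zero, Real.cos_pi_div_two] at e0 e1
  have hmm : (m : ℝ) ^ 2 = (1 - t) * s ^ 2 + t * r ^ 2 -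
      t * (1 - t) * (s ^ 2 + r ^ 2 - 2 * s * r * Real.cos (dist y y')) := by
    have h1 := Real.sin_sq_add_cos_sq φ
    have h2 := Real.sin_sq_add_cos_sq (dist y y')
    calc (m : ℝ) ^ 2 = (m * Real.cos φ) ^ 2 + (m * Real.sin φ) ^ 2 := by
          linear_combination -(m : ℝ) ^ 2 * h1
      _ = _ := by
          rw [e0, e1]
          linear_combination (t * r) ^ 2 * h2
  -- Unfold `x` to the planar direction `w - h` or `w + h`, so that its angle to `φ` is exact. The
  -- angle to one endpoint stays exact too; the cosine for the other endpoint can only grow.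
  have hmain : (1 - t) * (s * Real.cos (h + w)) + t * (r * Real.cos (h + (dist y y' - w))) ≤
      m * Real.cos (h + |φ - w|) := by
    have ht1 : 0 ≤ 1 - t := sub_nonneg.2 ht.2
    rcases le_total w φ with hle | hle
    · have e : h + |φ - w| = φ - (w - h) := by rw [abs_of_nonneg (sub_nonneg.2 hle)]; ring
      have e' : h + (dist y y' - w) = dist y y' - (w - h) := by ring
      rw [e, hm, e', Real.cos_sub w h, add_comm h w, Real.cos_add w h]
      have := mul_nonneg (Real.sin_nonneg_of_nonneg_of_le_pi hw.1 (hw.2.trans hα)) hsh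
      gcongr
      linarith
    · have e : h + |φ - w| = -(φ - (w + h)) := by
        rw [abs_sub_comm, abs_of_nonneg (sub_nonneg.2 hle)]; ring
      have e' : dist y y' - (w + h) = (dist y y' - w) - h := by ring
      rw [e, Real.cos_neg, hm, e', add_comm h w, add_comm h, Real.cos_add (_ - w),
        Real.cos_sub (_ - w)]
      have := mul_nonneg (Real.sin_nonneg_of_nonneg_of_le_pi (x := dist y y' - w)
        (sub_nonneg.2 hw.2) (by linarith [hw.1])) hsh
      have ht0 := ht.1
      gcongr
      linarith
  have := mul_le_mul_of_nonneg_left hmain σ.2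
  rw [hmm]
  simp only [NNReal.val_eq_coe] at this
  linarith

/-- A Cauchy sequence in the cone over a complete space converges, and unless the limit is the tip
its radii and directions both converge. -/
theorem exists_tendsto_of_cauchySeq [CompleteSpace Y] [Nonempty Y]
    (hY : ∀ x y : Y, dist x y ≤ Real.pi) {s : ℕ → ℝ≥0} {y : ℕ → Y}
    (hu : CauchySeq fun n => ray (s n) (y n)) :
    ∃ s' y', Filter.Tendsto (fun n => ray (s n) (y n)) Filter.atTop (𝓝 (ray s' y')) ∧
      Filter.Tendsto s Filter.atTop (𝓝 s') ∧
      (s' = 0 ∨ Filter.Tendsto y Filter.atTop (𝓝 y')) := by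
  obtain ⟨y₀⟩ := ‹Nonempty Y›
  have hs : CauchySeq s := by
    rw [Metric.cauchySeq_iff] at hu ⊢
    intro ε hε
    obtain ⟨N, hN⟩ := hu ε hε
    refine ⟨N, fun m hm n hn => lt_of_le_of_lt ?_ (hN m hm n hn)⟩
    rw [NNReal.dist_eq, ← dist_ray_zero hY (s m) (y m) y₀, ← dist_ray_zero hY (s n) (y n) y₀]
    exact abs_dist_sub_le _ _ _
  obtain ⟨s', hs'⟩ := cauchySeq_tendsto_of_complete hs
  have hsr : Filter.Tendsto (fun n => (s n : ℝ)) Filter.atTop (𝓝 (s' : ℝ)) :=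
    NNReal.tendsto_coe.2 hs'
  rcases eq_or_ne s' 0 with rfl | hs0
  · refine ⟨0, y₀, ?_, hs', Or.inl rfl⟩
    rw [tendsto_iff_dist_tendsto_zero]
    simp only [dist_ray_zero hY]
    exact hsr
  have hpos : (0 : ℝ) < s' := NNReal.coe_pos.2 (pos_iff_ne_zero.2 hs0)
  have hy : CauchySeq y := by
    rw [Metric.cauchySeq_iff] at hu ⊢
    intro ε hε
    -- With both radii above `s'/2`, the bound `1 - cos x ≥ 2x²/π²` makes the cone distance at least
    -- `(s'/π)` times the angle.
    obtain ⟨N, hN⟩ := hu (s' / Real.pi * ε) (by have := Real.pi_pos; positivity)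
    obtain ⟨N', hN'⟩ := Filter.eventually_atTop.1
      (hsr.eventually (lt_mem_nhds (half_lt_self hpos)))
    refine ⟨max N N', fun m hm n hn => ?_⟩
    have h1 := hN m (le_of_max_le_left hm) n (le_of_max_le_left hn)
    have h2 := hN' m (le_of_max_le_right hm)
    have h3 := hN' n (le_of_max_le_right hn)
    have h4 := dist_ray_sq hY (s m) (s n) (y m) (y n)
    have h5 := Real.cos_le_one_sub_mul_cos_sq (x := dist (y m) (y n))
      (by rw [abs_of_nonneg dist_nonneg]; exact hY _ _)
    have hpi := Real.pi_pos
    have h6 : (s' / 2 : ℝ) * (s' / 2) ≤ s m * s n := by gcongr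
    have h7 : (s' / Real.pi * dist (y m) (y n)) ^ 2 ≤
        dist (ray (s m) (y m)) (ray (s n) (y n)) ^ 2 := by
      rw [h4]
      have e : (s' / Real.pi * dist (y m) (y n)) ^ 2 =
          2 * (s' / 2 * (s' / 2)) * (2 / Real.pi ^ 2 * dist (y m) (y n) ^ 2) := by
        field_simp
      have h8 : 0 ≤ 2 / Real.pi ^ 2 * dist (y m) (y n) ^ 2 := by positivity
      have h9 := mul_le_mul_of_nonneg_right h6 h8
      have h10 : (s m * s n : ℝ) * (2 / Real.pi ^ 2 * dist (y m) (y n) ^ 2) ≤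
          s m * s n * (1 - Real.cos (dist (y m) (y n))) := by
        gcongr
        linarith
      rw [e]
      nlinarith [sq_nonneg ((s m : ℝ) - s n)]
    have h8 : s' / Real.pi * dist (y m) (y n) ≤ dist (ray (s m) (y m)) (ray (s n) (y n)) :=
      (sq_le_sq₀ (by positivity) dist_nonneg).1 h7
    exact lt_of_mul_lt_mul_left (h8.trans_lt h1) (by positivity)
  obtain ⟨y', hy'⟩ := cauchySeq_tendsto_of_complete hy
  refine ⟨s', y', ?_, hs', Or.inr hy'⟩
  rw [tendsto_iff_dist_tendsto_zero]
  simp only [dist_ray hY]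
  have hd : Filter.Tendsto (fun n => dist (y n) y') Filter.atTop (𝓝 0) :=
    tendsto_iff_dist_tendsto_zero.1 hy'
  have hlim : Filter.Tendsto (fun n => cosineSide (s n) s' (dist (y n) y')) Filter.atTop
      (𝓝 (cosineSide s' s' 0)) := by
    unfold cosineSide
    refine (Real.continuous_sqrt.tendsto _).comp ?_
    exact ((hsr.pow 2).add tendsto_const_nhds).sub
      (((tendsto_const_nhds.mul hsr).mul tendsto_const_nhds).mul
        ((Real.continuous_cos.tendsto 0).comp hd))
  convert hlim using 2
  rw [cosineSide, Real.cos_zero]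
  ring_nf
  simp

theorem metricBetween_ray (hY : ∀ x y : Y, dist x y ≤ Real.pi) {s t : ℝ≥0} (hst : s ≤ t)
    (x y : Y) : MetricBetween (ray 0 x) (ray s y) (ray t y) := by
  have hst' : (s : ℝ) ≤ t := hst
  unfold MetricBetween
  rw [dist_comm, dist_ray_zero hY, dist_comm _ (ray t y), dist_comm _ (ray t y),
    dist_ray_zero hY, dist_ray hY, dist_self, cosineSide, Real.cos_zero]
  have e : (t : ℝ) ^ 2 + s ^ 2 - 2 * t * s * 1 = (t - s) ^ 2 := by ring
  rw [e, Real.sqrt_sq (by linarith)]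
  ring

end EuclCone

/-! ### The tree `Y` in coordinates -/

namespace Example

/-- The point at distance `x` from `b n` on the edge from `b n` to `e n k`. -/
noncomputable def pt (n k : ℕ) (x : Edge) : Y := Wedge.mk (endpt 0) n (Wedge.mk edgeStart k x)

theorem exists_pt (y : Y) : ∃ n k x, y = pt n k x := by
  obtain ⟨n, y, rfl⟩ := Wedge.exists_mk y
  obtain ⟨k, x, rfl⟩ := Wedge.exists_mk y
  exact ⟨n, k, x, rfl⟩

theorem b_eq_pt (n k : ℕ) : b n = pt n k edgeStart := by
  unfold b centre pt
  rw [Wedge.mk_base 0 k]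

theorem e_eq_pt (n k : ℕ) : e n k = pt n k edgeEnd := rfl

theorem p_eq_pt (n : ℕ) : p = pt n 0 edgeEnd := Wedge.mk_base 0 n

theorem dist_edgeStart (x : Edge) : dist x edgeStart = x := by
  rw [Subtype.dist_eq, Real.dist_eq]
  simpa [edgeStart] using x.2.1

theorem dist_pt_same (n k : ℕ) (x y : Edge) : dist (pt n k x) (pt n k y) = |(x : ℝ) - y| := by
  unfold pt
  rw [Wedge.dist_mk_same, Wedge.dist_mk_same]
  rfl

theorem dist_pt_branch (n : ℕ) {k l : ℕ} (h : k ≠ l) (x y : Edge) :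
    dist (pt n k x) (pt n l y) = x + y := by
  unfold pt
  rw [Wedge.dist_mk_same, Wedge.dist_mk_of_ne h, dist_comm edgeStart, dist_edgeStart,
    dist_edgeStart]

theorem coe_edgeEnd : (edgeEnd : ℝ) = Real.pi / 4 := rfl

theorem coe_edgeStart : (edgeStart : ℝ) = 0 := rfl

theorem dist_p_pt (n k : ℕ) (x : Edge) :
    dist p (pt n k x) = if k = 0 then Real.pi / 4 - x else Real.pi / 4 + x := by
  rw [p_eq_pt n]
  split_ifs with h
  · subst h
    rw [dist_pt_same, coe_edgeEnd, abs_of_nonneg (sub_nonneg.2 x.2.2)]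
  · rw [dist_pt_branch n (Ne.symm h), coe_edgeEnd]

theorem dist_pt_of_ne {m n : ℕ} (h : m ≠ n) (k l : ℕ) (x y : Edge) :
    dist (pt m k x) (pt n l y) = dist p (pt m k x) + dist p (pt n l y) := by
  have h1 : ∀ n k x, dist p (pt n k x) = dist (endpt 0) (Wedge.mk edgeStart k x) := by
    intro n k x
    rw [p_eq_pt n]
    exact Wedge.dist_mk_same _ _ _
  rw [h1, h1, dist_comm (endpt 0)]
  exact Wedge.dist_mk_of_ne h _ _

theorem dist_p_le (y : Y) : dist p y ≤ Real.pi / 2 := by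
  obtain ⟨n, k, x, rfl⟩ := exists_pt y
  rw [dist_p_pt]
  have h1 := x.2.1
  have h2 := x.2.2
  split_ifs <;> linarith

theorem dist_le_pi (x y : Y) : dist x y ≤ Real.pi := by
  have h1 := dist_p_le x
  have h2 := dist_p_le y
  have h3 := dist_triangle_left x y p
  linarith

/-- The path between two points either is monotone with respect to the distance from `p` or turns
around at one of the branching points, which have distance `0` or `π/4` from `p`. -/
theorem turning_height (y y' : Y) :
    dist y y' = |dist p y - dist p y'| ∨ dist p y + dist p y' - dist y y' = 0 ∨
      dist p y + dist p y' - dist y y' = Real.pi / 2 := by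
  obtain ⟨n, k, x, rfl⟩ := exists_pt y
  obtain ⟨m, l, x', rfl⟩ := exists_pt y'
  have hx := x.2.1
  have hx' := x'.2.1
  by_cases hnm : n = m
  · subst hnm
    by_cases hkl : k = l
    · subst hkl
      left
      rw [dist_pt_same, dist_p_pt, dist_p_pt]
      split_ifs
      · rw [abs_sub_comm]
        congr 1
        ring
      · congr 1
        ring
    · rw [dist_pt_branch n hkl, dist_p_pt, dist_p_pt]
      split_ifs with h1 h2 h2
      · omega
      · left
        rw [abs_sub_comm, abs_of_nonneg] <;> linarith
      · left
        rw [abs_of_nonneg] <;> linarith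
      · right; right
        ring
  · right; left
    rw [dist_pt_of_ne hnm, sub_self]

theorem isMetricTree_Y : IsMetricTree Y :=
  Wedge.isMetricTree (Wedge.isMetricTree (isMetricTree_Icc _ _))

instance completeSpace_Y : CompleteSpace Y :=
  have : CompleteSpace Edge := isClosed_Icc.completeSpace_coe
  have : CompleteSpace Y₁ := Wedge.completeSpace
  Wedge.completeSpace

theorem dist_b_pt (n k : ℕ) (x : Edge) : dist (b n) (pt n k x) = x := by
  rw [b_eq_pt n k, dist_pt_same, coe_edgeStart, zero_sub, abs_neg, abs_of_nonneg x.2.1]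

theorem dist_pt_e (n k : ℕ) (x : Edge) : dist (pt n k x) (e n k) = Real.pi / 4 - x := by
  rw [e_eq_pt, dist_pt_same, coe_edgeEnd, abs_sub_comm, abs_of_nonneg (sub_nonneg.2 x.2.2)]

theorem dist_b_e (n k : ℕ) : dist (b n) (e n k) = Real.pi / 4 := by
  rw [e_eq_pt, dist_b_pt, coe_edgeEnd]

theorem dist_p_b (n : ℕ) : dist p (b n) = Real.pi / 4 := by
  rw [b_eq_pt n 0, dist_p_pt, if_pos rfl, coe_edgeStart, sub_zero]

theorem dist_p_e (n : ℕ) {k : ℕ} (hk : k ≠ 0) : dist p (e n k) = Real.pi / 2 := by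
  rw [e_eq_pt, dist_p_pt, if_neg hk, coe_edgeEnd]
  ring

/-! ### The set `X` in polar coordinates -/

/-- Membership of `s · y` in `X`, in terms of the distance of `y` from `p`. -/
def InRegion (s : ℝ≥0) (y : Y) : Prop :=
  s * Real.cos (dist p y - Real.pi / 8) ≤ 2 * Real.cos (Real.pi / 8) ∧
    s * Real.cos (dist p y - 3 * Real.pi / 8) ≤ 2 * Real.cos (Real.pi / 8)

/-- A half-plane condition is linear along a planar segment. At a turning point `w` of the path,
unfolding preserves it provided `sin g ≤ 0`; if `w` is an end of the path, there is nothing to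
unfold. -/
theorem segment_cos_le {s r m t φ α g w K : ℝ} (hs : 0 ≤ s) (hr : 0 ≤ r)
    (ht : t ∈ Set.Icc (0 : ℝ) 1) (hα : α ≤ Real.pi) (hφ : φ ∈ Set.Icc 0 α)
    (hw : w ∈ Set.Icc 0 α)
    (hm : ∀ β, m * Real.cos (φ - β) =
      (1 - t) * (s * Real.cos β) + t * (r * Real.cos (α - β)))
    (hg : Real.sin g ≤ 0 ∨ w = 0 ∨ w = α)
    (h0 : s * Real.cos (g + w) ≤ K) (h1 : r * Real.cos (g + (α - w)) ≤ K) :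
    m * Real.cos (g + |φ - w|) ≤ K := by
  have ht1 : 0 ≤ 1 - t := sub_nonneg.2 ht.2
  have right : w ≤ φ → Real.sin w * Real.sin g ≤ 0 → m * Real.cos (g + |φ - w|) ≤ K := by
    intro hle hsin
    have e : g + |φ - w| = φ - (w - g) := by rw [abs_of_nonneg (sub_nonneg.2 hle)]; ring
    have e' : g + (α - w) = α - (w - g) := by ring
    have h2 : s * Real.cos (w - g) ≤ K := by
      refine le_trans ?_ h0
      rw [add_comm g w, Real.cos_add, Real.cos_sub]
      gcongr
      linarith
    rw [e, hm, ← e']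
    have h3 := mul_le_mul_of_nonneg_left h2 ht1
    have h4 := mul_le_mul_of_nonneg_left h1 ht.1
    linarith
  have left : φ ≤ w → Real.sin (α - w) * Real.sin g ≤ 0 →
      m * Real.cos (g + |φ - w|) ≤ K := by
    intro hle hsin
    have e : g + |φ - w| = -(φ - (g + w)) := by
      rw [abs_sub_comm, abs_of_nonneg (sub_nonneg.2 hle)]; ring
    have e' : α - (g + w) = (α - w) - g := by ring
    have h2 : r * Real.cos (α - (g + w)) ≤ K := by
      refine le_trans ?_ h1
      rw [e', add_comm g, Real.cos_add, Real.cos_sub]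
      gcongr
      linarith
    rw [e, Real.cos_neg, hm]
    have h3 := mul_le_mul_of_nonneg_left h0 ht1
    have h4 := mul_le_mul_of_nonneg_left h2 ht.1
    linarith
  rcases hg with hg | rfl | rfl
  · rcases le_total w φ with h | h
    · exact right h (mul_nonpos_of_nonneg_of_nonpos
        (Real.sin_nonneg_of_nonneg_of_le_pi hw.1 (hw.2.trans hα)) hg)
    · exact left h (mul_nonpos_of_nonneg_of_nonpos
        (Real.sin_nonneg_of_nonneg_of_le_pi (sub_nonneg.2 hw.2) (by linarith [hw.1])) hg)
  · exact right hφ.1 (by simp)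
  · exact left hφ.2 (by simp)

/-- This is the convexity of `X`. With `k` the distance from `p` to the path, the unfolding argument
works for the inequality centred at `a` as soon as `k ≤ a`. -/
theorem exists_isBarycentre_inRegion {s r : ℝ≥0} {y y' : Y} (h : InRegion s y)
    (h' : InRegion r y') {t : ℝ} (ht : t ∈ Set.Icc (0 : ℝ) 1) :
    ∃ m z, InRegion m z ∧
      IsBarycentre t (EuclCone.ray s y) (EuclCone.ray r y') (EuclCone.ray m z) := by
  obtain ⟨c, hc0, hc1, hc⟩ := isMetricTree_Y y y'
  obtain ⟨m, φ, hm0, hφ, hm⟩ := exists_polar_segment s.2 r.2 ht dist_nonneg (dist_le_pi y y')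
  refine ⟨⟨m, hm0⟩, c φ, ?_,
    EuclCone.isBarycentre_ray dist_le_pi hc0 hc1 hc (m := ⟨m, hm0⟩) ht hφ hm⟩
  obtain ⟨k, w, hk, hw, H⟩ := hc p
  have hα := dist_le_pi y y'
  have hα0 : 0 ≤ dist y y' := dist_nonneg
  have hpi := Real.pi_pos
  have d0 := H 0 ⟨le_rfl, hα0⟩
  have d1 := H _ ⟨hα0, le_rfl⟩
  have dφ := H φ hφ
  rw [hc0, zero_sub, abs_neg, abs_of_nonneg hw.1] at d0
  rw [hc1, abs_of_nonneg (sub_nonneg.2 hw.2)] at d1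
  have hk2 : k ≤ Real.pi / 2 := by linarith [dist_p_le y, hw.1]
  have key : ∀ a : ℝ, Real.sin (k - a) ≤ 0 ∨ w = 0 ∨ w = dist y y' →
      s * Real.cos (dist p y - a) ≤ 2 * Real.cos (Real.pi / 8) →
      r * Real.cos (dist p y' - a) ≤ 2 * Real.cos (Real.pi / 8) →
      m * Real.cos (dist p (c φ) - a) ≤ 2 * Real.cos (Real.pi / 8) := by
    intro a ha e0 e1
    have i : ∀ v, k + v - a = (k - a) + v := fun v => by ring
    rw [d0, i] at e0
    rw [d1, i] at e1
    rw [dφ, i]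
    exact segment_cos_le s.2 r.2 ht hα hφ hw hm ha e0 e1
  have hsin : ∀ a : ℝ, k ≤ a → a ≤ Real.pi → Real.sin (k - a) ≤ 0 := fun a h1 h2 =>
    Real.sin_nonpos_of_nonpos_of_neg_pi_le (by linarith) (by linarith)
  have hcases : k = 0 ∨ k = Real.pi / 4 ∨ w = 0 ∨ w = dist y y' := by
    rcases turning_height y y' with h1 | h1 | h1
    · right; right
      rcases abs_choice (dist p y - dist p y') with h2 | h2 <;> rw [h2] at h1
      · right; linarith
      · left; linarith
    · left; linarith
    · right; left; linarith
  rcases hcases with h0 | h0 | h0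
  · exact ⟨key _ (Or.inl (hsin _ (by linarith) (by linarith))) h.1 h'.1,
      key _ (Or.inl (hsin _ (by linarith) (by linarith))) h.2 h'.2⟩
  -- For `k = π/4` the inequality at `π/8` cannot be unfolded, but the path stays at distance at
  -- least `π/4` from `p`, where the inequality at `3π/8` implies it.
  · have h3 : m * Real.cos (dist p (c φ) - 3 * Real.pi / 8) ≤ 2 * Real.cos (Real.pi / 8) :=
      key _ (Or.inl (hsin _ (by linarith) (by linarith))) h.2 h'.2
    refine ⟨le_trans (mul_le_mul_of_nonneg_left ?_ hm0) h3, h3⟩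
    have h4 := dist_p_le (c φ)
    have h5 := abs_nonneg (φ - w)
    rw [← Real.cos_abs (_ - 3 * Real.pi / 8)]
    refine Real.cos_le_cos_of_nonneg_of_le_pi (abs_nonneg _) (by linarith) ?_
    rw [abs_le]
    constructor <;> linarith
  · exact ⟨key _ (Or.inr h0) h.1 h'.1, key _ (Or.inr h0) h.2 h'.2⟩

theorem exists_inRegion_of_between {s r : ℝ≥0} {y y' : Y} (h : InRegion s y)
    (h' : InRegion r y') {z : EuclCone Y}
    (hz : MetricBetween (EuclCone.ray s y) z (EuclCone.ray r y')) :
    ∃ m x, InRegion m x ∧ z = EuclCone.ray m x := by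
  obtain ⟨t, ht, h1, h2⟩ := hz.exists_ratio
  obtain ⟨m, x, hm, hb⟩ := exists_isBarycentre_inRegion h h' ht
  exact ⟨m, x, hm, hb.eq_of_dist h1 h2⟩

theorem cos_pi_div_eight_pos : 0 < Real.cos (Real.pi / 8) :=
  Real.cos_pos_of_mem_Ioo ⟨by linarith [Real.pi_pos], by linarith [Real.pi_pos]⟩

theorem one_le_two_mul_cos : 1 ≤ 2 * Real.cos (Real.pi / 8) := by
  have h1 := Real.cos_le_cos_of_nonneg_of_le_pi (x := Real.pi / 8) (y := Real.pi / 3)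
    (by linarith [Real.pi_pos]) (by linarith [Real.pi_pos]) (by linarith [Real.pi_pos])
  rw [Real.cos_pi_div_three] at h1
  linarith

theorem inRegion_of_le_one {s : ℝ≥0} (hs : s ≤ 1) (y : Y) : InRegion s y := by
  have hs' : (s : ℝ) ≤ 1 := hs
  have h : ∀ a, s * Real.cos a ≤ 2 * Real.cos (Real.pi / 8) := fun a =>
    calc s * Real.cos a ≤ s * 1 := mul_le_mul_of_nonneg_left (Real.cos_le_one a) s.2
      _ ≤ _ := by rw [mul_one]; exact hs'.trans one_le_two_mul_cos
  exact ⟨h _, h _⟩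

theorem inRegion_two {y : Y} (hy : dist p y = 0 ∨ dist p y = Real.pi / 4 ∨
    dist p y = Real.pi / 2) : InRegion 2 y := by
  have hpi := Real.pi_pos
  have h : ∀ a : ℝ, Real.pi / 8 ≤ |a| → |a| ≤ Real.pi →
      ((2 : ℝ≥0) : ℝ) * Real.cos a ≤ 2 * Real.cos (Real.pi / 8) := by
    intro a h1 h2
    rw [← Real.cos_abs a]
    exact mul_le_mul_of_nonneg_left
      (Real.cos_le_cos_of_nonneg_of_le_pi (by linarith) h2 h1) (by norm_num)
  constructor
  · apply h
    · rw [le_abs]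
      rcases hy with h | h | h <;> rw [h]
      · right; linarith
      · left; linarith
      · left; linarith
    · rw [abs_le]
      rcases hy with h | h | h <;> rw [h] <;> constructor <;> linarith
  · apply h
    · rw [le_abs]
      rcases hy with h | h | h <;> rw [h]
      · right; linarith
      · right; linarith
      · left; linarith
    · rw [abs_le]
      rcases hy with h | h | h <;> rw [h] <;> constructor <;> linarith

theorem InRegion.le_two {s : ℝ≥0} {y : Y} (h : InRegion s y) : s ≤ 2 := by
  have h1 : ∃ a : ℝ, |a| ≤ Real.pi / 8 ∧ s * Real.cos a ≤ 2 * Real.cos (Real.pi / 8) := by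
    have h2 := dist_p_le y
    have h3 : 0 ≤ dist p y := dist_nonneg
    rcases le_total (dist p y) (Real.pi / 4) with h4 | h4
    · exact ⟨_, abs_le.2 ⟨by linarith, by linarith⟩, h.1⟩
    · exact ⟨_, abs_le.2 ⟨by linarith, by linarith⟩, h.2⟩
  obtain ⟨a, ha, h2⟩ := h1
  rw [← Real.cos_abs a] at h2
  have h3 := Real.cos_le_cos_of_nonneg_of_le_pi (abs_nonneg a) (by linarith [Real.pi_pos]) ha
  have h4 := (mul_le_mul_of_nonneg_left h3 s.2).trans h2
  have h5 : (s : ℝ) ≤ 2 := le_of_mul_le_mul_right h4 cos_pi_div_eight_pos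
  exact_mod_cast h5

/-- The distance between two points on a line at distance `K` from the origin, in polar
coordinates relative to the foot point of the origin. -/
theorem cosineSide_chord {K u v : ℝ} (hK : 0 ≤ K) (hu : 0 < Real.cos u) (hv : 0 < Real.cos v)
    (h : Real.tan u ≤ Real.tan v) :
    cosineSide (K / Real.cos u) (K / Real.cos v) (v - u) = K * (Real.tan v - Real.tan u) := by
  rw [cosineSide, ← Real.sqrt_sq (mul_nonneg hK (sub_nonneg.2 h))]
  congr 1
  rw [Real.tan_eq_sin_div_cos, Real.tan_eq_sin_div_cos, Real.cos_sub]
  have h1 := Real.sin_sq_add_cos_sq u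
  have h2 := Real.sin_sq_add_cos_sq v
  field_simp
  linear_combination (-K ^ 2 * Real.cos v ^ 2) * h1 - K ^ 2 * Real.cos u ^ 2 * h2

/-- In a sector of angle `π/4` the side opposite `o` lies on the line at distance `2 cos (π/8)` from
`o`, with foot in the middle direction; this direction is at distance `π/8` or `3π/8` from `p`.
Triangles lie in the region because their vertices do and the region is convex. -/
theorem mem_X_iff (z : EuclCone Y) : z ∈ X ↔ ∃ s y, InRegion s y ∧ z = EuclCone.ray s y := by
  constructor
  · intro hz
    simp only [X, Set.mem_iUnion] at hz
    obtain ⟨n, k, w, hw, hz⟩ := hz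
    have hb : InRegion 2 (b n) := inRegion_two (Or.inr (Or.inl (dist_p_b n)))
    have he : InRegion 2 (e n k) := by
      rcases eq_or_ne k 0 with rfl | hk
      · exact inRegion_two (Or.inl (by rw [e_eq_pt, ← p_eq_pt, dist_self]))
      · exact inRegion_two (Or.inr (Or.inr (dist_p_e n hk)))
    obtain ⟨s, y, hs, rfl⟩ := exists_inRegion_of_between hb he hw
    exact exists_inRegion_of_between (inRegion_of_le_one zero_le_one p) hs hz
  · rintro ⟨s, y, hs, rfl⟩
    obtain ⟨n, k, x, rfl⟩ := exists_pt y
    simp only [X, Set.mem_iUnion]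
    have hpi := Real.pi_pos
    have hx0 := x.2.1
    have hx1 := x.2.2
    have hcos : 0 < Real.cos (x - Real.pi / 8) :=
      Real.cos_pos_of_mem_Ioo ⟨by linarith, by linarith⟩
    have hc := cos_pi_div_eight_pos
    have hsx : s * Real.cos (x - Real.pi / 8) ≤ 2 * Real.cos (Real.pi / 8) := by
      have h1 := hs.1
      have h2 := hs.2
      rw [dist_p_pt] at h1 h2
      split_ifs at h1 h2
      · rw [← Real.cos_neg]
        convert h1 using 3
        ring
      · convert h2 using 3
        ring
    set K := 2 * Real.cos (Real.pi / 8) with hK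
    have hK0 : 0 ≤ K := by positivity
    -- `ρ` is the radius at which the ray in direction `pt n k x` meets the side opposite `o`.
    set ρ : ℝ≥0 := ⟨K / Real.cos (x - Real.pi / 8), div_nonneg hK0 hcos.le⟩ with hρ
    have hρ' : (ρ : ℝ) = K / Real.cos (x - Real.pi / 8) := rfl
    have h2 : ((2 : ℝ≥0) : ℝ) = K / Real.cos (Real.pi / 8) := by
      rw [hK]
      field_simp
      rfl
    have h2' : ((2 : ℝ≥0) : ℝ) = K / Real.cos (-(Real.pi / 8)) := by rw [Real.cos_neg, h2]
    have hc' : 0 < Real.cos (-(Real.pi / 8)) := by rwa [Real.cos_neg]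
    have hmono : ∀ u v : ℝ, -(Real.pi / 8) ≤ u → u ≤ v → v ≤ Real.pi / 8 →
        Real.tan u ≤ Real.tan v := fun u v h1 h2 h3 =>
      Real.strictMonoOn_tan.monotoneOn ⟨by linarith, by linarith⟩ ⟨by linarith, by linarith⟩ h2
    refine ⟨n, k, EuclCone.ray ρ (pt n k x), ?_, ?_⟩
    · unfold MetricBetween
      rw [EuclCone.dist_ray dist_le_pi, EuclCone.dist_ray dist_le_pi,
        EuclCone.dist_ray dist_le_pi, dist_b_pt, dist_pt_e, dist_b_e]
      have e1 := cosineSide_chord hK0 hc' hcos (hmono _ _ le_rfl (by linarith) (by linarith))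
      have e2 := cosineSide_chord hK0 hcos hc (hmono _ _ (by linarith) (by linarith) le_rfl)
      have e3 := cosineSide_chord hK0 hc' hc (hmono _ _ le_rfl (by linarith) le_rfl)
      rw [← h2', ← hρ', show (x : ℝ) - Real.pi / 8 - -(Real.pi / 8) = x by ring] at e1
      rw [← h2, ← hρ', show Real.pi / 8 - ((x : ℝ) - Real.pi / 8) = Real.pi / 4 - x by ring]
        at e2
      rw [← h2, ← h2', show Real.pi / 8 - -(Real.pi / 8) = Real.pi / 4 by ring] at e3
      rw [e1, e2, e3]
      ring
    · refine EuclCone.metricBetween_ray dist_le_pi ?_ p _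
      rw [← NNReal.coe_le_coe, hρ', le_div_iff₀ hcos]
      exact hsx

theorem ray_mem_X {s : ℝ≥0} (hs : s ≤ 1) (y : Y) : EuclCone.ray s y ∈ X :=
  (mem_X_iff _).2 ⟨s, y, inRegion_of_le_one hs y, rfl⟩

theorem hasBarycentres_X : HasBarycentres X := by
  rintro ⟨q, hq⟩ ⟨r, hr⟩ t ht
  obtain ⟨s, y, hs, rfl⟩ := (mem_X_iff q).1 hq
  obtain ⟨s', y', hs', rfl⟩ := (mem_X_iff r).1 hr
  obtain ⟨m, z, hm, hb⟩ := exists_isBarycentre_inRegion hs hs' ht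
  exact ⟨⟨_, (mem_X_iff _).2 ⟨m, z, hm, rfl⟩⟩, fun P => hb P⟩

instance nonempty_Y : Nonempty Y := ⟨p⟩

instance completeSpace_X : CompleteSpace X := by
  refine Metric.complete_of_cauchySeq_tendsto fun u hu => ?_
  choose s y hs hu' using fun n => (mem_X_iff (u n)).1 (u n).2
  have hu1 : CauchySeq fun n => EuclCone.ray (s n) (y n) := by
    simp only [← hu']
    exact uniformContinuous_subtype_val.comp_cauchySeq hu
  obtain ⟨s', y', h1, h2, h3⟩ := EuclCone.exists_tendsto_of_cauchySeq dist_le_pi hu1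
  have hmem : EuclCone.ray s' y' ∈ X := by
    rcases h3 with rfl | h3
    · exact ray_mem_X zero_le_one y'
    · refine (mem_X_iff _).2 ⟨s', y', ?_, rfl⟩
      have hlim : ∀ a, Filter.Tendsto (fun n => s n * Real.cos (dist p (y n) - a)) Filter.atTop
          (𝓝 (s' * Real.cos (dist p y' - a))) := fun a =>
        (NNReal.tendsto_coe.2 h2).mul ((Real.continuous_cos.tendsto _).comp
          ((tendsto_const_nhds.dist h3).sub_const a))
      exact ⟨le_of_tendsto' (hlim _) fun n => (hs n).1, le_of_tendsto' (hlim _) fun n => (hs n).2⟩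
  refine ⟨⟨_, hmem⟩, tendsto_subtype_rng.2 ?_⟩
  simpa only [hu'] using h1

theorem isBounded_X : Bornology.IsBounded (Set.univ : Set X) := by
  rw [Metric.isBounded_iff_subset_closedBall (⟨o, ray_mem_X zero_le_one p⟩ : X)]
  refine ⟨2, fun z _ => ?_⟩
  obtain ⟨s, y, hs, hz⟩ := (mem_X_iff z).1 z.2
  rw [Metric.mem_closedBall, Subtype.dist_eq, hz]
  change dist (EuclCone.ray s y) (EuclCone.ray 0 p) ≤ 2
  rw [EuclCone.dist_ray_zero dist_le_pi]
  exact_mod_cast hs.le_two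

end Example

/-! ### Right angles, opposite rays and perpendicular feet in the cone -/

namespace EuclCone

variable {Y : Type} [MetricSpace Y]

/-- In an isosceles right triangle with legs `s`, the midpoint of the hypotenuse lies on the
bisector at distance `s/√2` from the apex. -/
theorem metricBetween_right_angle (hY : ∀ x y : Y, dist x y ≤ Real.pi) {s t : ℝ≥0}
    (hst : (t : ℝ) = s * (√2 / 2)) {x y z : Y} (hxy : dist x y = Real.pi / 4)
    (hyz : dist y z = Real.pi / 4) (hxz : dist x z = Real.pi / 2) :
    MetricBetween (ray s x) (ray t y) (ray s z) := by
  have h2 : √2 ^ 2 = (2 : ℝ) := Real.sq_sqrt (by norm_num)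
  have e1 : dist (ray s x) (ray t y) = s * (√2 / 2) := by
    rw [← sq_eq_sq₀ dist_nonneg (by positivity), dist_ray_sq hY, hxy, hst,
      Real.cos_pi_div_four]
    linear_combination (-(s : ℝ) ^ 2 / 2) * h2
  have e2 : dist (ray t y) (ray s z) = s * (√2 / 2) := by
    rw [← sq_eq_sq₀ dist_nonneg (by positivity), dist_ray_sq hY, hyz, hst,
      Real.cos_pi_div_four]
    linear_combination (-(s : ℝ) ^ 2 / 2) * h2
  have e3 : dist (ray s x) (ray s z) = s * √2 := by
    rw [← sq_eq_sq₀ dist_nonneg (by positivity), dist_ray_sq hY, hxz, Real.cos_pi_div_two]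
    linear_combination (-(s : ℝ) ^ 2) * h2
  unfold MetricBetween
  rw [e1, e2, e3]
  ring

theorem metricBetween_opposite (hY : ∀ x y : Y, dist x y ≤ Real.pi) (s t : ℝ≥0)
    {x z : Y} (y : Y) (hxz : dist x z = Real.pi) :
    MetricBetween (ray s x) (ray 0 y) (ray t z) := by
  unfold MetricBetween
  rw [dist_comm (ray 0 y), dist_ray_zero hY, dist_ray_zero hY, dist_ray hY, hxz, cosineSide,
    Real.cos_pi, show (s : ℝ) ^ 2 + t ^ 2 - 2 * s * t * -1 = (s + t) ^ 2 by ring,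
    Real.sqrt_sq (by positivity)]

/-- The foot of the perpendicular from `σ · v` to the ray in direction `w` is closer to `σ · v`
than any other point `s · y` whose direction is separated from `v` by `w`. -/
theorem dist_foot_lt (hY : ∀ x y : Y, dist x y ≤ Real.pi) {σ τ s : ℝ≥0}
    (hτ : (τ : ℝ) = σ * (√2 / 2)) {v w y : Y} (hvy : dist v y = Real.pi / 4 + dist w y)
    (hσ : 0 < σ) (hne : ray s y ≠ ray τ w) :
    cosineSide σ τ (Real.pi / 4) < cosineSide σ s (Real.pi / 4 + dist w y) := by
  unfold cosineSide
  refine Real.sqrt_lt_sqrt (cosineSide_arg_nonneg _ _ _) ?_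
  have h2 : √2 ^ 2 = (2 : ℝ) := Real.sq_sqrt (by norm_num)
  have hpi := Real.pi_pos
  have hle := hY v y
  rw [hvy] at hle
  have hσ' : (0 : ℝ) < σ := hσ
  have e : (σ : ℝ) ^ 2 + τ ^ 2 - 2 * σ * τ * Real.cos (Real.pi / 4) = σ ^ 2 / 2 := by
    rw [hτ, Real.cos_pi_div_four]
    linear_combination (-(σ : ℝ) ^ 2 / 4) * h2
  rw [e]
  have e2 : (σ : ℝ) ^ 2 + s ^ 2 - 2 * σ * s * (√2 / 2) = σ ^ 2 / 2 + (s - τ) ^ 2 := by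
    rw [hτ]
    linear_combination (-(σ : ℝ) ^ 2 / 4) * h2
  -- At angle exactly `π/4` the excess is `(s - τ)²`. If that vanishes, the directions differ and
  -- the angle is strictly larger.
  by_cases hs : (s : ℝ) = τ
  · have hs' : s = τ := NNReal.coe_injective hs
    have hpos : 0 < dist w y := by
      rw [dist_pos]
      rintro rfl
      exact hne (by rw [hs'])
    have h3 := Real.cos_lt_cos_of_nonneg_of_le_pi (x := Real.pi / 4)
      (y := Real.pi / 4 + dist w y) (by positivity) hle (by linarith)
    rw [Real.cos_pi_div_four] at h3
    have hs0 : (0 : ℝ) < s := by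
      rw [hs, hτ]
      positivity
    have h4 := mul_lt_mul_of_pos_left h3 (mul_pos hσ' hs0)
    nlinarith [sq_nonneg ((s : ℝ) - τ)]
  · have h3 := Real.cos_le_cos_of_nonneg_of_le_pi (x := Real.pi / 4)
      (y := Real.pi / 4 + dist w y) (by positivity) hle
      (by linarith [dist_nonneg (x := w) (y := y)])
    rw [Real.cos_pi_div_four] at h3
    have h4 := mul_le_mul_of_nonneg_left h3 (mul_nonneg σ.2 s.2)
    have h5 : 0 < ((s : ℝ) - τ) ^ 2 := sq_pos_of_ne_zero (sub_ne_zero.2 hs)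
    simp only [NNReal.val_eq_coe] at h4
    linarith

end EuclCone

/-! ### Excluding weak limits: `A` is weakly closed -/

theorem WeaklyConverges.not_frequently_closer {X : Type} [MetricSpace X]
    (hX : HasBarycentres X) {u : ℕ → X} {x : X} (h : WeaklyConverges u x) (z : X) {d₁ d₂ : ℝ}
    (hd : d₁ < d₂) : ¬ ∃ᶠ n in Filter.atTop, dist (u n) z = d₁ ∧ dist (u n) x = d₂ := by
  intro hf
  obtain ⟨n, ⟨h1, h2⟩, h3⟩ :=
    (hf.and_eventually (h.eventually_dist_le hX z (sub_pos.2 hd))).exists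
  linarith

theorem WeaklyConverges.eq_of_frequently_eq {X : Type} [MetricSpace X]
    (hX : HasBarycentres X) {u : ℕ → X} {x : X} (h : WeaklyConverges u x) {z : X}
    (hf : ∃ᶠ n in Filter.atTop, u n = z) : x = z := by
  by_contra hne
  refine h.not_frequently_closer hX z (dist_pos.2 (Ne.symm hne)) (hf.mono fun n hn => ?_)
  rw [hn, dist_self]
  exact ⟨rfl, rfl⟩

namespace Example

theorem coe_inv_sqrt_two : ((1 / NNReal.sqrt 2 : ℝ≥0) : ℝ) = √2 / 2 := by
  have h2 : √2 * √2 = (2 : ℝ) := Real.mul_self_sqrt (by norm_num)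
  have h0 : (0 : ℝ) < √2 := by positivity
  rw [NNReal.coe_div, NNReal.coe_one, Real.coe_sqrt, NNReal.coe_ofNat]
  field_simp
  linarith

theorem inv_sqrt_two_le_one : (1 / NNReal.sqrt 2 : ℝ≥0) ≤ 1 := by
  rw [← NNReal.coe_le_coe, coe_inv_sqrt_two, NNReal.coe_one]
  have h2 : √2 * √2 = (2 : ℝ) := Real.mul_self_sqrt (by norm_num)
  nlinarith [Real.sqrt_nonneg 2]

theorem half_le_one : (1 / 2 : ℝ≥0) ≤ 1 := by
  rw [← NNReal.coe_le_coe]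
  norm_num

theorem mem_A_iff (z : EuclCone Y) : z ∈ A ↔ (∃ n k, k ≠ 0 ∧ z = EuclCone.ray 1 (e n k)) ∨
    (∃ n, z = EuclCone.ray (1 / NNReal.sqrt 2) (b n)) ∨ z = EuclCone.ray (1 / 2) p ∨ z = o := by
  simp only [A, E, B, Set.mem_union, Set.mem_image, Set.mem_ofPred_eq, Set.mem_singleton_iff,
    or_assoc]
  refine or_congr ?_ (or_congr ?_ Iff.rfl)
  · constructor
    · rintro ⟨_, ⟨n, k, hk, rfl⟩, rfl⟩
      exact ⟨n, k, by omega, rfl⟩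
    · rintro ⟨n, k, hk, rfl⟩
      exact ⟨_, ⟨n, k, by omega, rfl⟩, rfl⟩
  · constructor
    · rintro ⟨_, ⟨n, rfl⟩, rfl⟩
      exact ⟨n, rfl⟩
    · rintro ⟨n, rfl⟩
      exact ⟨_, ⟨n, rfl⟩, rfl⟩

theorem A_subset_X : A ⊆ X := by
  intro z hz
  rcases (mem_A_iff z).1 hz with ⟨n, k, -, rfl⟩ | ⟨n, rfl⟩ | rfl | rfl
  · exact ray_mem_X le_rfl _
  · exact ray_mem_X inv_sqrt_two_le_one _
  · exact ray_mem_X half_le_one _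
  · exact ray_mem_X zero_le_one _

theorem half_eq : ((1 / 2 : ℝ≥0) : ℝ) = (1 / NNReal.sqrt 2 : ℝ≥0) * (√2 / 2) := by
  have h2 : √2 * √2 = (2 : ℝ) := Real.mul_self_sqrt (by norm_num)
  rw [coe_inv_sqrt_two]
  push_cast
  linarith

theorem inv_sqrt_two_eq : ((1 / NNReal.sqrt 2 : ℝ≥0) : ℝ) = (1 : ℝ≥0) * (√2 / 2) := by
  rw [coe_inv_sqrt_two, NNReal.coe_one, one_mul]

/-- If `x ∉ A`, the terms are classified by their position relative to the edge `(n₀, k₀)` carrying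
`x`. One of the seven classes occurs infinitely often; in it, either the terms are constant or some
`z ∈ A` lies at a fixed distance from them, smaller than the equally fixed distance of `x`. -/
theorem isWeaklyClosed_A : IsWeaklyClosed {x : X | (x : EuclCone Y) ∈ A} := by
  intro u x hu _ hx
  by_contra hxA
  have hxA' : (x : EuclCone Y) ∉ A := hxA
  have hX := hasBarycentres_X
  obtain ⟨s, y, -, hxs⟩ := (mem_X_iff x).1 x.2
  obtain ⟨n₀, k₀, v, rfl⟩ := exists_pt y
  have hconst : ∀ z ∈ A, ¬ ∃ᶠ j in Filter.atTop, (u j : EuclCone Y) = z := by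
    intro z hz hf
    have := hx.eq_of_frequently_eq hX (z := ⟨z, A_subset_X hz⟩)
      (hf.mono fun j hj => Subtype.ext hj)
    exact hxA' (by rw [this]; exact hz)
  have hclose : ∀ z ∈ A, ∀ d₁ d₂ : ℝ, d₁ < d₂ → ¬ ∃ᶠ j in Filter.atTop,
      dist (u j : EuclCone Y) z = d₁ ∧ dist (u j : EuclCone Y) x = d₂ := fun z hz d₁ d₂ hd =>
    hx.not_frequently_closer hX ⟨z, A_subset_X hz⟩ hd
  have hcases : ∀ j, (∃ n k, n ≠ n₀ ∧ k ≠ 0 ∧ (u j : EuclCone Y) = EuclCone.ray 1 (e n k)) ∨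
      (∃ k, k ≠ k₀ ∧ (u j : EuclCone Y) = EuclCone.ray 1 (e n₀ k)) ∨
      (k₀ ≠ 0 ∧ (u j : EuclCone Y) = EuclCone.ray 1 (e n₀ k₀)) ∨
      (∃ n, n ≠ n₀ ∧ (u j : EuclCone Y) = EuclCone.ray (1 / NNReal.sqrt 2) (b n)) ∨
      (u j : EuclCone Y) = EuclCone.ray (1 / NNReal.sqrt 2) (b n₀) ∨
      (u j : EuclCone Y) = EuclCone.ray (1 / 2) p ∨ (u j : EuclCone Y) = o := by
    intro j
    rcases (mem_A_iff _).1 (hu j) with ⟨n, k, hk, h⟩ | ⟨n, h⟩ | h | h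
    · by_cases hn : n = n₀
      · subst hn
        by_cases hk' : k = k₀
        · subst hk'
          exact Or.inr (Or.inr (Or.inl ⟨hk, h⟩))
        · exact Or.inr (Or.inl ⟨k, hk', h⟩)
      · exact Or.inl ⟨n, k, hn, hk, h⟩
    · by_cases hn : n = n₀
      · subst hn
        exact Or.inr (Or.inr (Or.inr (Or.inr (Or.inl h))))
      · exact Or.inr (Or.inr (Or.inr (Or.inl ⟨n, hn, h⟩)))
    · exact Or.inr (Or.inr (Or.inr (Or.inr (Or.inr (Or.inl h)))))
    · exact Or.inr (Or.inr (Or.inr (Or.inr (Or.inr (Or.inr h)))))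
  have hf := Filter.Frequently.of_forall (f := Filter.atTop) hcases
  simp only [Filter.frequently_or_distrib] at hf
  have ho : o ∈ A := (mem_A_iff _).2 (Or.inr (Or.inr (Or.inr rfl)))
  have hp : EuclCone.ray (1 / 2) p ∈ A := (mem_A_iff _).2 (Or.inr (Or.inr (Or.inl rfl)))
  have hb : ∀ n, EuclCone.ray (1 / NNReal.sqrt 2) (b n) ∈ A := fun n =>
    (mem_A_iff _).2 (Or.inr (Or.inl ⟨n, rfl⟩))
  rw [hxs] at hxA' hclose
  have hpi := Real.pi_pos
  have hne : ∀ z ∈ A, EuclCone.ray s (pt n₀ k₀ v) ≠ z := fun z hz h => hxA' (by rwa [h])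
  rcases hf with hf | hf | hf | hf | hf | hf | hf
  · have hs : 0 < s := by
      rw [pos_iff_ne_zero]
      rintro rfl
      exact hne o ho (EuclCone.ray_zero dist_le_pi _ _)
    -- Endpoints in other copies make an angle of at least `π/2` with `x` at the tip, so `o` is
    -- strictly closer.
    refine hclose o ho 1 (cosineSide 1 s (Real.pi / 2 + dist p (pt n₀ k₀ v))) ?_
      (hf.mono fun j hj => ?_)
    · rw [cosineSide, Real.lt_sqrt zero_le_one]
      have h1 : Real.cos (Real.pi / 2 + dist p (pt n₀ k₀ v)) ≤ 0 :=
        Real.cos_nonpos_of_pi_div_two_le_of_le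
          (by linarith [dist_nonneg (x := p) (y := pt n₀ k₀ v)])
          (by linarith [dist_p_le (pt n₀ k₀ v)])
      have hs' : (0 : ℝ) < s := hs
      nlinarith [mul_nonneg hs'.le (neg_nonneg.2 h1), pow_pos hs' 2]
    · obtain ⟨n, k, hn, hk, h⟩ := hj
      rw [h]
      refine ⟨EuclCone.dist_ray_zero dist_le_pi _ _ _, ?_⟩
      rw [EuclCone.dist_ray dist_le_pi, e_eq_pt, dist_pt_of_ne hn, ← e_eq_pt, dist_p_e n hk]
      rfl
  · have hd : ∀ k, k ≠ k₀ →
        dist (e n₀ k) (pt n₀ k₀ v) = Real.pi / 4 + dist (b n₀) (pt n₀ k₀ v) := fun k hk => by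
      rw [e_eq_pt, dist_pt_branch n₀ hk, dist_b_pt, coe_edgeEnd]
    have hd' : ∀ k, dist (e n₀ k) (b n₀) = Real.pi / 4 := fun k => by rw [dist_comm, dist_b_e]
    -- The distances do not depend on `k ≠ k₀`, so the strict inequality is checked at `k₀ + 1`.
    refine hclose _ (hb n₀) _ _ (EuclCone.dist_foot_lt dist_le_pi inv_sqrt_two_eq
      (hd (k₀ + 1) (by omega)) one_pos (hne _ (hb n₀))) (hf.mono fun j hj => ?_)
    obtain ⟨k, hk, h⟩ := hj
    rw [h, EuclCone.dist_ray dist_le_pi, EuclCone.dist_ray dist_le_pi, hd k hk, hd' k]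
    exact ⟨rfl, rfl⟩
  · obtain ⟨j, hk, -⟩ := hf.exists
    exact hconst _ ((mem_A_iff _).2 (Or.inl ⟨n₀, k₀, hk, rfl⟩)) (hf.mono fun j hj => hj.2)
  · have hd : ∀ n, n ≠ n₀ →
        dist (b n) (pt n₀ k₀ v) = Real.pi / 4 + dist p (pt n₀ k₀ v) := fun n hn => by
      rw [b_eq_pt n 0, dist_pt_of_ne hn, ← b_eq_pt, dist_p_b]
    have hd' : ∀ n, dist (b n) p = Real.pi / 4 := fun n => by rw [dist_comm, dist_p_b]
    have hpos : (0 : ℝ≥0) < 1 / NNReal.sqrt 2 := by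
      rw [← NNReal.coe_pos, coe_inv_sqrt_two]
      positivity
    refine hclose _ hp _ _ (EuclCone.dist_foot_lt dist_le_pi half_eq
      (hd (n₀ + 1) (by omega)) hpos (hne _ hp)) (hf.mono fun j hj => ?_)
    obtain ⟨n, hn, h⟩ := hj
    rw [h, EuclCone.dist_ray dist_le_pi, EuclCone.dist_ray dist_le_pi, hd n hn, hd' n]
    exact ⟨rfl, rfl⟩
  · exact hconst _ (hb n₀) hf
  · exact hconst _ hp hf
  · exact hconst _ ho hf

/-! ### The point `(1/4)·p` in the coconvex topology -/

theorem quarter_p_notMem_A : EuclCone.ray (1 / 4) p ∉ A := by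
  have hr : dist (EuclCone.ray (1 / 4) p) (o : EuclCone Y) = 1 / 4 := by
    rw [o, EuclCone.dist_ray_zero dist_le_pi]
    norm_num
  intro h
  rcases (mem_A_iff _).1 h with ⟨n, k, -, h⟩ | ⟨n, h⟩ | h | h
  · rw [h, o, EuclCone.dist_ray_zero dist_le_pi] at hr
    norm_num at hr
  · rw [h, o, EuclCone.dist_ray_zero dist_le_pi, coe_inv_sqrt_two] at hr
    have h2 : √2 * √2 = (2 : ℝ) := Real.mul_self_sqrt (by norm_num)
    nlinarith
  · rw [h, o, EuclCone.dist_ray_zero dist_le_pi] at hr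
    norm_num at hr
  · rw [h, dist_self] at hr
    norm_num at hr

/-- The point `(1/4)·p`. -/
noncomputable def quarterPoint : X :=
  ⟨EuclCone.ray (1 / 4) p, ray_mem_X (by rw [← NNReal.coe_le_coe]; norm_num) p⟩

/-- The endpoint number `k + 1` at `b n`. -/
noncomputable def endPoint (n k : ℕ) : X := ⟨EuclCone.ray 1 (e n (k + 1)), ray_mem_X le_rfl _⟩

theorem quarterPoint_mem_of_convex {C : Set X} (hC : IsGeodConvex C) {m n k l k' l' : ℕ}
    (hmn : m ≠ n) (hkl : k ≠ l) (hkl' : k' ≠ l') (h1 : endPoint m k ∈ C)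
    (h2 : endPoint m l ∈ C) (h3 : endPoint n k' ∈ C) (h4 : endPoint n l' ∈ C) :
    quarterPoint ∈ C := by
  have hbranch : ∀ {n k l : ℕ}, k ≠ l → endPoint n k ∈ C → endPoint n l ∈ C →
      (⟨EuclCone.ray (1 / NNReal.sqrt 2) (b n), ray_mem_X inv_sqrt_two_le_one _⟩ : X) ∈ C := by
    intro n k l hkl h1 h2
    refine hC _ h1 _ h2 _ (EuclCone.metricBetween_right_angle dist_le_pi inv_sqrt_two_eq
      (x := e n (k + 1)) (z := e n (l + 1)) ?_ (dist_b_e n _) ?_)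
    · rw [dist_comm, dist_b_e]
    · rw [e_eq_pt, e_eq_pt, dist_pt_branch n (by omega), coe_edgeEnd]
      ring
  have hp : (⟨EuclCone.ray (1 / 2) p, ray_mem_X half_le_one _⟩ : X) ∈ C := by
    refine hC _ (hbranch hkl h1 h2) _ (hbranch hkl' h3 h4) _
      (EuclCone.metricBetween_right_angle dist_le_pi half_eq
        (x := b m) (z := b n) ?_ (dist_p_b n) ?_)
    · rw [dist_comm, dist_p_b]
    · rw [b_eq_pt m 0, b_eq_pt n 0, dist_pt_of_ne hmn, ← b_eq_pt, ← b_eq_pt, dist_p_b, dist_p_b]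
      ring
  -- Endpoints in different copies are at distance `π` in `Y`, so the segment between them passes
  -- through the tip.
  have ho : (⟨EuclCone.ray 0 p, ray_mem_X zero_le_one _⟩ : X) ∈ C := by
    refine hC _ h1 _ h3 _ (EuclCone.metricBetween_opposite dist_le_pi 1 1
      (x := e m (k + 1)) (z := e n (k' + 1)) p ?_)
    rw [e_eq_pt, e_eq_pt, dist_pt_of_ne hmn, ← e_eq_pt, ← e_eq_pt, dist_p_e _ (by omega),
      dist_p_e _ (by omega)]
    ring
  refine hC _ ho _ hp _ (EuclCone.metricBetween_ray dist_le_pi (s := 1 / 4) (t := 1 / 2) ?_ p p)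
  rw [← NNReal.coe_le_coe]
  norm_num

/-- A basic neighbourhood missing `A` colours each endpoint by one of finitely many convex sets
containing it. Pigeonhole within each copy, then over the copies, gives four endpoints of one
colour, and that convex set contains `(1/4)·p`. -/
theorem quarterPoint_mem_closure :
    quarterPoint ∈ @closure X (coconvexTopology X) {x : X | (x : EuclCone Y) ∈ A} := by
  have hbasis := @TopologicalSpace.isTopologicalBasis_of_subbasis X (coconvexTopology X) _ rfl
  rw [@TopologicalSpace.IsTopologicalBasis.mem_closure_iff X (coconvexTopology X) _ hbasis]
  rintro _ ⟨f, ⟨hfin, hf⟩, rfl⟩ hq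
  by_contra hempty
  have hcol : ∀ n k, ∃ U : f, endPoint n k ∉ (U : Set X) := by
    intro n k
    by_contra! h
    exact hempty ⟨endPoint n k, fun U hU => h ⟨U, hU⟩,
      (mem_A_iff _).2 (Or.inl ⟨n, k + 1, by omega, rfl⟩)⟩
  choose F hF using hcol
  have : Finite f := hfin
  have hpair : ∀ n, ∃ k l, k ≠ l ∧ F n k = F n l := fun n =>
    Finite.exists_ne_map_eq_of_infinite (F n)
  choose k l hkl hFkl using hpair
  obtain ⟨m, n, hmn, hFmn⟩ := Finite.exists_ne_map_eq_of_infinite fun n => F n (k n)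
  have hFmn' : F m (k m) = F n (k n) := hFmn
  refine quarterPoint_mem_of_convex (hf (F m (k m)).2).2 hmn (hkl m) (hkl n) (hF _ _) ?_ ?_ ?_
    (hq _ (F m (k m)).2)
  · rw [hFkl]
    exact hF _ _
  · rw [hFmn']
    exact hF _ _
  · rw [hFmn', hFkl]
    exact hF _ _

end Example

theorem mainTheorem9 :
    IsCAT0 Example.X ∧
    Bornology.IsBounded (Set.univ : Set Example.X) ∧
    Example.A ⊆ Example.X ∧
    IsClosed[weakTopology Example.X] {x : Example.X | (x : EuclCone Example.Y) ∈ Example.A} ∧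
    (∃ q : Example.X, (q : EuclCone Example.Y) = EuclCone.ray (1 / 4) Example.p ∧
      (q : EuclCone Example.Y) ∉ Example.A ∧
      q ∈ @closure Example.X (coconvexTopology Example.X)
        {x : Example.X | (x : EuclCone Example.Y) ∈ Example.A}) ∧
    weakTopology Example.X ≠ coconvexTopology Example.X := by
  have hclosed : IsClosed[weakTopology Example.X]
      {x : Example.X | (x : EuclCone Example.Y) ∈ Example.A} := by
    refine @IsClosed.mk _ (weakTopology Example.X) _ ?_
    change IsWeaklyClosed _
    rw [compl_compl]
    exact Example.isWeaklyClosed_A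
  refine ⟨Example.hasBarycentres_X.isCAT0, Example.isBounded_X, Example.A_subset_X, hclosed,
    ⟨Example.quarterPoint, rfl, Example.quarter_p_notMem_A,
      Example.quarterPoint_mem_closure⟩, fun h => ?_⟩
  rw [h] at hclosed
  have hmem := Example.quarterPoint_mem_closure
  rw [@IsClosed.closure_eq _ (coconvexTopology Example.X) _ hclosed] at hmem
  exact Example.quarter_p_notMem_A hmem
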